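/- **Proposition.** Let $\theta\in\mathbb R$ and let $A$ be the noncommutative algebraic 2-torus: the unital $\mathbb C$-algebra generated by invertible elements $u,v$ with the relation $uv=e^{-i\theta}vu$. Let $H=\mathbb C[t,t^{-1}]$, and let $\delta:A\to A\otimes H$ be the algebra map with $\delta(u)=u\otimes t$ and $\delta(v)=v\otimes t^{-1}$, a right coaction of the Hopf algebra $H$ ($t$ group-like). Its subalgebra of coinvariants is $B=\{a\in A:\delta(a)=a\otimes 1\}$. Let $\Omega^\bullet(A)$ be the differential calculus on $A$ generated by $A$ and $du,dv$ with the relations $$du\,u=u\,du,\quad dv\,v=v\,dv,\quad du\,v=e^{-i\theta}v\,du,\quad dv\,u=e^{i\theta}u\,dv,$$ $$du\wedge du=dv\wedge dv=0,\qquad du\wedge dv+e^{-i\theta}dv\wedge du=0,$$ and let $\Omega^\bullet(H)$ be the differential calculus on $H$ generated by $H$ and $dt$ with $dt\,t=t\,dt$ and $dt\wedge dt=0$. The calculus $\Omega^\bullet(A)$ is complete: $\delta$ extends to a morphism of differential graded algebras $\Delta:\Omega^\bullet(A)\to\Omega^\bullet(A)\otimes\Omega^\bullet(H)$ into the graded tensor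 product. The base 1-forms are $\Omega^1(B)=\{\omega\in\Omega^1(A):\Delta(\omega)=\omega\otimes 1\}$. A 1-form $\omega$ on $A$ is called horizontal if $\Delta(\omega)\in\Omega^\bullet(A)\otimes H$, and coinvariant if $(\mathrm{id}\otimes\pi_0)\Delta(\omega)=\omega\otimes 1$, where $\pi_0:\Omega^\bullet(H)\to\Omega^0(H)=H$ is the projection to degree $0$. Then $$\Omega^1(B)=B\,dB=\operatorname{span}_{\mathbb C}\{b\,db' : b,b'\in B\},$$ and the space of coinvariant horizontal 1-forms is $$\operatorname{span}_{\mathbb C}\{(uv)^k\,d(uv):k\in\mathbb Z\}.$$ -/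

import Mathlib

open scoped TensorProduct DirectSum LaurentPolynomial

/-! ### Differential calculi over algebras -/

section General

variable {A H ΩA ΩH : Type} [Ring A] [Algebra ℂ A] [Ring H] [Algebra ℂ H]
  [Ring ΩA] [Algebra ℂ ΩA] [Ring ΩH] [Algebra ℂ ΩH]

/-- `span {a⁰ da¹ ∧ ⋯ ∧ daᵏ : a⁰, …, aᵏ ∈ A}`, for an algebra `A` mapped by `i` to an algebra of
forms with differential `d`. -/
def formGrade (i : A →ₐ[ℂ] ΩA) (d : ΩA →ₗ[ℂ] ΩA) (k : ℕ) : Submodule ℂ ΩA :=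
  LinearMap.range i.toLinearMap * LinearMap.range (d ∘ₗ i.toLinearMap) ^ k

/-- Differential graded algebras over `ℂ`, graded by `ℕ`. -/
structure IsDGAlgebra (G : ℕ → Submodule ℂ ΩA) [GradedAlgebra G] (d : ΩA →ₗ[ℂ] ΩA) : Prop where
  d_mem : ∀ k, ∀ x ∈ G k, d x ∈ G (k + 1)
  d_d : ∀ x, d (d x) = 0
  leibniz : ∀ k, ∀ x ∈ G k, ∀ y, d (x * y) = d x * y + (-1 : ℂ) ^ k • (x * d y)

/-- A differential calculus on `A`: a differential graded algebra whose degree zero part is `A`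
(embedded by `i`) and which is generated in degree zero. -/
structure IsDifferentialCalculus (i : A →ₐ[ℂ] ΩA) (G : ℕ → Submodule ℂ ΩA) [GradedAlgebra G]
    (d : ΩA →ₗ[ℂ] ΩA) : Prop extends IsDGAlgebra G d where
  injective : Function.Injective i
  grade_zero : G 0 = LinearMap.range i.toLinearMap
  generated : ∀ k, G k = formGrade i d k

/-- The map equal to `(-1)ᵏ` in degree `k`. -/
noncomputable def gradeSign (G : ℕ → Submodule ℂ ΩA) [GradedAlgebra G] : ΩA →ₗ[ℂ] ΩA :=
  DirectSum.toModule ℂ ℕ ΩA (fun k => (-1 : ℂ) ^ k • (G k).subtype) ∘ₗ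
    (DirectSum.decomposeLinearEquiv G).toLinearMap

/-- The differential `x ⊗ y ↦ dx ⊗ y + (-1)^|x| x ⊗ dy` on the graded tensor product. -/
noncomputable def tensorD (G : ℕ → Submodule ℂ ΩA) [GradedAlgebra G] (d : ΩA →ₗ[ℂ] ΩA)
    (K : ℕ → Submodule ℂ ΩH) [GradedAlgebra K] (e : ΩH →ₗ[ℂ] ΩH) :
    (G ᵍ⊗[ℂ] K) →ₗ[ℂ] (G ᵍ⊗[ℂ] K) :=
  (GradedTensorProduct.of ℂ G K).toLinearMap ∘ₗ
    (TensorProduct.map d LinearMap.id + TensorProduct.map (gradeSign G) e) ∘ₗ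
      (GradedTensorProduct.of ℂ G K).symm.toLinearMap

/-- The part of total degree `k` of the graded tensor product. -/
noncomputable def tensorGrade (G : ℕ → Submodule ℂ ΩA) [GradedAlgebra G]
    (K : ℕ → Submodule ℂ ΩH) [GradedAlgebra K] (k : ℕ) : Submodule ℂ (G ᵍ⊗[ℂ] K) :=
  Submodule.span ℂ {z | ∃ m n, m + n = k ∧ ∃ x ∈ G m, ∃ y ∈ K n, z = x ᵍ⊗ₜ[ℂ] y}

/-- `Δ` is a morphism of differential graded algebras `Ω(A) → Ω(A) ⊗ Ω(H)` (graded tensor product)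
extending the coaction `δ : A → A ⊗ H`; a calculus having such a morphism is called complete. -/
structure IsCompleteExtension (iA : A →ₐ[ℂ] ΩA) (G : ℕ → Submodule ℂ ΩA) [GradedAlgebra G]
    (d : ΩA →ₗ[ℂ] ΩA) (iH : H →ₐ[ℂ] ΩH) (K : ℕ → Submodule ℂ ΩH) [GradedAlgebra K]
    (e : ΩH →ₗ[ℂ] ΩH) (δ : A →ₐ[ℂ] A ⊗[ℂ] H) (Δ : ΩA →ₐ[ℂ] G ᵍ⊗[ℂ] K) : Prop where
  extends_coaction : ∀ a, Δ (iA a) = GradedTensorProduct.of ℂ G K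
    (TensorProduct.map iA.toLinearMap iH.toLinearMap (δ a))
  map_d : ∀ x, Δ (d x) = tensorD G d K e (Δ x)
  map_grade : ∀ k, ∀ x ∈ G k, Δ x ∈ tensorGrade G K k

/-- The coinvariants `B = {a ∈ A : δ(a) = a ⊗ 1}` of a coaction. -/
def coinvariants (δ : A →ₐ[ℂ] A ⊗[ℂ] H) : Subalgebra ℂ A :=
  AlgHom.equalizer δ Algebra.TensorProduct.includeLeft

section Forms

variable (G : ℕ → Submodule ℂ ΩA) [GradedAlgebra G] (K : ℕ → Submodule ℂ ΩH) [GradedAlgebra K]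
  (Δ : ΩA →ₐ[ℂ] G ᵍ⊗[ℂ] K)

/-- The base forms of degree `k`: forms `ω` with `Δ(ω) = ω ⊗ 1`. -/
noncomputable def baseForms (k : ℕ) : Submodule ℂ ΩA :=
  G k ⊓ LinearMap.eqLocus Δ.toLinearMap (GradedTensorProduct.includeLeft G K).toLinearMap

/-- The horizontal forms of degree `k`: forms `ω` with `Δ(ω) ∈ Ω(A) ⊗ H`, where `H` is the degree
zero part of `Ω(H)`. -/
noncomputable def horizontalForms (k : ℕ) : Submodule ℂ ΩA :=
  G k ⊓ (LinearMap.range ((GradedTensorProduct.of ℂ G K).toLinearMap ∘ₗ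
    TensorProduct.map LinearMap.id (K 0).subtype)).comap Δ.toLinearMap

/-- The right coaction `(id ⊗ π₀) ∘ Δ` on forms, where `π₀` is the projection of `Ω(H)` to its
degree zero part `H`. -/
noncomputable def formCoaction : ΩA →ₗ[ℂ] G ᵍ⊗[ℂ] K :=
  (GradedTensorProduct.of ℂ G K).toLinearMap ∘ₗ
    TensorProduct.map LinearMap.id (GradedAlgebra.proj K 0) ∘ₗ
      (GradedTensorProduct.of ℂ G K).symm.toLinearMap ∘ₗ Δ.toLinearMap

/-- The right coinvariant forms of degree `k`. -/
noncomputable def coinvariantForms (k : ℕ) : Submodule ℂ ΩA :=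
  G k ⊓ LinearMap.eqLocus (formCoaction G K Δ)
    (GradedTensorProduct.includeLeft G K).toLinearMap

end Forms

/-- The forms `B dB = span {b db' : b, b' ∈ B}` for a subalgebra `B` of `A`. -/
def subalgebraForms (i : A →ₐ[ℂ] ΩA) (d : ΩA →ₗ[ℂ] ΩA) (B : Subalgebra ℂ A) : Submodule ℂ ΩA :=
  Submodule.span ℂ {z | ∃ b ∈ B, ∃ b' ∈ B, z = i b * d (i b')}

end General

/-! ### The algebras -/

inductive TorusGen
  | u | uInv | v | vInv

open TorusGen in
/-- The relations of the noncommutative torus; `u` and `v` are invertible and `uv = e^{-iθ} vu`. -/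
inductive TorusRel (θ : ℝ) : FreeAlgebra ℂ TorusGen → FreeAlgebra ℂ TorusGen → Prop
  | u_uInv : TorusRel θ (FreeAlgebra.ι ℂ u * FreeAlgebra.ι ℂ uInv) 1
  | uInv_u : TorusRel θ (FreeAlgebra.ι ℂ uInv * FreeAlgebra.ι ℂ u) 1
  | v_vInv : TorusRel θ (FreeAlgebra.ι ℂ v * FreeAlgebra.ι ℂ vInv) 1
  | vInv_v : TorusRel θ (FreeAlgebra.ι ℂ vInv * FreeAlgebra.ι ℂ v) 1
  | comm : TorusRel θ (FreeAlgebra.ι ℂ u * FreeAlgebra.ι ℂ v)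
      (Complex.exp (-(θ * Complex.I)) • (FreeAlgebra.ι ℂ v * FreeAlgebra.ι ℂ u))

/-- The noncommutative algebraic 2-torus. -/
def NCTorus (θ : ℝ) : Type := RingQuot (TorusRel θ)

noncomputable instance (θ : ℝ) : Ring (NCTorus θ) := inferInstanceAs (Ring (RingQuot (TorusRel θ)))

noncomputable instance (θ : ℝ) : Algebra ℂ (NCTorus θ) :=
  inferInstanceAs (Algebra ℂ (RingQuot (TorusRel θ)))

namespace NCTorus

/-- The generators of the torus algebra. -/
noncomputable def gen (θ : ℝ) (g : TorusGen) : NCTorus θ :=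
  RingQuot.mkAlgHom ℂ (TorusRel θ) (FreeAlgebra.ι ℂ g)

theorem gen_u_uInv (θ : ℝ) : gen θ .u * gen θ .uInv = 1 := by
  have := RingQuot.mkAlgHom_rel ℂ (TorusRel.u_uInv (θ := θ))
  rwa [map_mul, map_one] at this

theorem gen_uInv_u (θ : ℝ) : gen θ .uInv * gen θ .u = 1 := by
  have := RingQuot.mkAlgHom_rel ℂ (TorusRel.uInv_u (θ := θ))
  rwa [map_mul, map_one] at this

theorem gen_v_vInv (θ : ℝ) : gen θ .v * gen θ .vInv = 1 := by
  have := RingQuot.mkAlgHom_rel ℂ (TorusRel.v_vInv (θ := θ))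
  rwa [map_mul, map_one] at this

theorem gen_vInv_v (θ : ℝ) : gen θ .vInv * gen θ .v = 1 := by
  have := RingQuot.mkAlgHom_rel ℂ (TorusRel.vInv_v (θ := θ))
  rwa [map_mul, map_one] at this

theorem gen_comm (θ : ℝ) :
    gen θ .u * gen θ .v = Complex.exp (-(θ * Complex.I)) • (gen θ .v * gen θ .u) := by
  have := RingQuot.mkAlgHom_rel ℂ (TorusRel.comm (θ := θ))
  rwa [map_mul, map_smul, map_mul] at this

/-- The invertible element `u`. -/
noncomputable def u (θ : ℝ) : (NCTorus θ)ˣ :=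
  ⟨gen θ .u, gen θ .uInv, gen_u_uInv θ, gen_uInv_u θ⟩

/-- The invertible element `v`. -/
noncomputable def v (θ : ℝ) : (NCTorus θ)ˣ :=
  ⟨gen θ .v, gen θ .vInv, gen_v_vInv θ, gen_vInv_v θ⟩

/-- Algebra maps out of the torus are given by images of the generators that satisfy the relations. -/
noncomputable def lift {θ : ℝ} {C : Type*} [Ring C] [Algebra ℂ C] (f : TorusGen → C)
    (h1 : f .u * f .uInv = 1) (h2 : f .uInv * f .u = 1)
    (h3 : f .v * f .vInv = 1) (h4 : f .vInv * f .v = 1)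
    (h5 : f .u * f .v = Complex.exp (-(θ * Complex.I)) • (f .v * f .u)) : NCTorus θ →ₐ[ℂ] C :=
  RingQuot.liftAlgHom ℂ ⟨FreeAlgebra.lift ℂ f, by
    rintro _ _ (_ | _ | _ | _ | _) <;> simpa⟩

theorem lift_gen {θ : ℝ} {C : Type*} [Ring C] [Algebra ℂ C] (f : TorusGen → C)
    (h1 : f .u * f .uInv = 1) (h2 : f .uInv * f .u = 1)
    (h3 : f .v * f .vInv = 1) (h4 : f .vInv * f .v = 1)
    (h5 : f .u * f .v = Complex.exp (-(θ * Complex.I)) • (f .v * f .u)) (g : TorusGen) :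
    lift f h1 h2 h3 h4 h5 (gen θ g) = f g := by
  unfold lift gen
  exact (RingQuot.liftAlgHom_mkAlgHom_apply ℂ _ _ _).trans (by simp)

theorem induction {θ : ℝ} {P : NCTorus θ → Prop} (hc : ∀ c : ℂ, P (algebraMap ℂ _ c))
    (hg : ∀ g, P (gen θ g)) (ha : ∀ x y, P x → P y → P (x + y))
    (hm : ∀ x y, P x → P y → P (x * y)) (x : NCTorus θ) : P x := by
  obtain ⟨y, rfl⟩ := RingQuot.mkAlgHom_surjective ℂ (TorusRel θ) x
  induction y using FreeAlgebra.induction with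
  | grade0 r => rw [AlgHom.commutes]; exact hc r
  | grade1 g => exact hg g
  | mul a b h1 h2 => rw [map_mul]; exact hm _ _ h1 h2
  | add a b h1 h2 => rw [map_add]; exact ha _ _ h1 h2

theorem hom_ext {θ : ℝ} {C : Type*} [Ring C] [Algebra ℂ C] {f g : NCTorus θ →ₐ[ℂ] C}
    (h : ∀ x, f (gen θ x) = g (gen θ x)) : f = g := by
  ext x
  induction x using NCTorus.induction with
  | hc c => simp
  | hg x => exact h x
  | ha x y hx hy => simp [hx, hy]
  | hm x y hx hy => simp [hx, hy]

end NCTorus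

/-- The right coaction of `ℂ[t, t⁻¹]` on the torus: `u ↦ u ⊗ t`, `v ↦ v ⊗ t⁻¹`. -/
noncomputable def torusCoaction (θ : ℝ) : NCTorus θ →ₐ[ℂ] NCTorus θ ⊗[ℂ] ℂ[T;T⁻¹] :=
  NCTorus.lift
    (fun
      | .u => NCTorus.gen θ .u ⊗ₜ LaurentPolynomial.T 1
      | .uInv => NCTorus.gen θ .uInv ⊗ₜ LaurentPolynomial.T (-1)
      | .v => NCTorus.gen θ .v ⊗ₜ LaurentPolynomial.T (-1)
      | .vInv => NCTorus.gen θ .vInv ⊗ₜ LaurentPolynomial.T 1)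
    (by
      rw [Algebra.TensorProduct.tmul_mul_tmul, NCTorus.gen_u_uInv, ← LaurentPolynomial.T_add]
      rfl)
    (by
      rw [Algebra.TensorProduct.tmul_mul_tmul, NCTorus.gen_uInv_u, ← LaurentPolynomial.T_add]
      rfl)
    (by
      rw [Algebra.TensorProduct.tmul_mul_tmul, NCTorus.gen_v_vInv, ← LaurentPolynomial.T_add]
      rfl)
    (by
      rw [Algebra.TensorProduct.tmul_mul_tmul, NCTorus.gen_vInv_v, ← LaurentPolynomial.T_add]
      rfl)
    (by
      rw [Algebra.TensorProduct.tmul_mul_tmul, NCTorus.gen_comm, ← LaurentPolynomial.T_add,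
        Algebra.TensorProduct.tmul_mul_tmul, ← LaurentPolynomial.T_add, TensorProduct.smul_tmul']
      rfl)

/-! ### The calculus on the torus -/

inductive TorusFormGen
  | fn (g : TorusGen) | du | dv

/-- The word in the generators of the algebra of forms corresponding to a word in those of the
torus. -/
noncomputable def TorusFormGen.incl : FreeAlgebra ℂ TorusGen →ₐ[ℂ] FreeAlgebra ℂ TorusFormGen :=
  FreeAlgebra.lift ℂ fun g => FreeAlgebra.ι ℂ (.fn g)

open TorusGen TorusFormGen in
/-- The relations of the calculus on the torus: those of the torus, the bimodule relations
`du u = u du`, `dv v = v dv`, `du v = e^{-iθ} v du`, `dv u = e^{iθ} u dv`, and those which follow by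
differentiating the latter, `du ∧ du = 0`, `dv ∧ dv = 0`, `du ∧ dv + e^{-iθ} dv ∧ du = 0`. -/
inductive TorusFormRel (θ : ℝ) :
    FreeAlgebra ℂ TorusFormGen → FreeAlgebra ℂ TorusFormGen → Prop
  | fn (x y) (h : TorusRel θ x y) : TorusFormRel θ (incl x) (incl y)
  | du_u : TorusFormRel θ (FreeAlgebra.ι ℂ du * FreeAlgebra.ι ℂ (fn u))
      (FreeAlgebra.ι ℂ (fn u) * FreeAlgebra.ι ℂ du)
  | dv_v : TorusFormRel θ (FreeAlgebra.ι ℂ dv * FreeAlgebra.ι ℂ (fn v))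
      (FreeAlgebra.ι ℂ (fn v) * FreeAlgebra.ι ℂ dv)
  | du_v : TorusFormRel θ (FreeAlgebra.ι ℂ du * FreeAlgebra.ι ℂ (fn v))
      (Complex.exp (-(θ * Complex.I)) • (FreeAlgebra.ι ℂ (fn v) * FreeAlgebra.ι ℂ du))
  | dv_u : TorusFormRel θ (FreeAlgebra.ι ℂ dv * FreeAlgebra.ι ℂ (fn u))
      (Complex.exp (θ * Complex.I) • (FreeAlgebra.ι ℂ (fn u) * FreeAlgebra.ι ℂ dv))
  | du_du : TorusFormRel θ (FreeAlgebra.ι ℂ du * FreeAlgebra.ι ℂ du) 0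
  | dv_dv : TorusFormRel θ (FreeAlgebra.ι ℂ dv * FreeAlgebra.ι ℂ dv) 0
  | du_dv : TorusFormRel θ (FreeAlgebra.ι ℂ du * FreeAlgebra.ι ℂ dv +
      Complex.exp (-(θ * Complex.I)) • (FreeAlgebra.ι ℂ dv * FreeAlgebra.ι ℂ du)) 0

/-- The algebra of differential forms on the noncommutative torus. -/
def TorusForm (θ : ℝ) : Type := RingQuot (TorusFormRel θ)

noncomputable instance (θ : ℝ) : Ring (TorusForm θ) :=
  inferInstanceAs (Ring (RingQuot (TorusFormRel θ)))

noncomputable instance (θ : ℝ) : Algebra ℂ (TorusForm θ) :=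
  inferInstanceAs (Algebra ℂ (RingQuot (TorusFormRel θ)))

namespace TorusForm

/-- The generators of the algebra of forms. -/
noncomputable def gen (θ : ℝ) (g : TorusFormGen) : TorusForm θ :=
  RingQuot.mkAlgHom ℂ (TorusFormRel θ) (FreeAlgebra.ι ℂ g)

theorem gen_du_u (θ : ℝ) : gen θ .du * gen θ (.fn .u) = gen θ (.fn .u) * gen θ .du := by
  have := RingQuot.mkAlgHom_rel ℂ (TorusFormRel.du_u (θ := θ))
  rwa [map_mul, map_mul] at this

theorem gen_dv_v (θ : ℝ) : gen θ .dv * gen θ (.fn .v) = gen θ (.fn .v) * gen θ .dv := by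
  have := RingQuot.mkAlgHom_rel ℂ (TorusFormRel.dv_v (θ := θ))
  rwa [map_mul, map_mul] at this

theorem gen_du_v (θ : ℝ) : gen θ .du * gen θ (.fn .v) =
    Complex.exp (-(θ * Complex.I)) • (gen θ (.fn .v) * gen θ .du) := by
  have := RingQuot.mkAlgHom_rel ℂ (TorusFormRel.du_v (θ := θ))
  rwa [map_mul, map_smul, map_mul] at this

theorem gen_dv_u (θ : ℝ) : gen θ .dv * gen θ (.fn .u) =
    Complex.exp (θ * Complex.I) • (gen θ (.fn .u) * gen θ .dv) := by
  have := RingQuot.mkAlgHom_rel ℂ (TorusFormRel.dv_u (θ := θ))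
  rwa [map_mul, map_smul, map_mul] at this

theorem gen_du_du (θ : ℝ) : gen θ .du * gen θ .du = 0 := by
  have := RingQuot.mkAlgHom_rel ℂ (TorusFormRel.du_du (θ := θ))
  rwa [map_mul, map_zero] at this

theorem gen_dv_dv (θ : ℝ) : gen θ .dv * gen θ .dv = 0 := by
  have := RingQuot.mkAlgHom_rel ℂ (TorusFormRel.dv_dv (θ := θ))
  rwa [map_mul, map_zero] at this

theorem gen_du_dv (θ : ℝ) : gen θ .du * gen θ .dv +
    Complex.exp (-(θ * Complex.I)) • (gen θ .dv * gen θ .du) = 0 := by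
  have := RingQuot.mkAlgHom_rel ℂ (TorusFormRel.du_dv (θ := θ))
  rwa [map_add, map_mul, map_smul, map_mul, map_zero] at this

/-- The inclusion of the torus algebra as the algebra of 0-forms. -/
noncomputable def incl (θ : ℝ) : NCTorus θ →ₐ[ℂ] TorusForm θ :=
  RingQuot.liftAlgHom ℂ ⟨(RingQuot.mkAlgHom ℂ (TorusFormRel θ)).comp TorusFormGen.incl,
    fun _ _ h => RingQuot.mkAlgHom_rel ℂ (TorusFormRel.fn _ _ h)⟩

theorem incl_gen (θ : ℝ) (g : TorusGen) : incl θ (NCTorus.gen θ g) = gen θ (.fn g) := by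
  unfold incl NCTorus.gen
  refine (RingQuot.liftAlgHom_mkAlgHom_apply ℂ _ _ _).trans ?_
  exact congrArg (RingQuot.mkAlgHom ℂ (TorusFormRel θ)) (FreeAlgebra.lift_ι_apply _ _)

theorem gen_u_uInv (θ : ℝ) : gen θ (.fn .u) * gen θ (.fn .uInv) = 1 := by
  rw [← incl_gen, ← incl_gen, ← map_mul, NCTorus.gen_u_uInv, map_one]

theorem gen_uInv_u (θ : ℝ) : gen θ (.fn .uInv) * gen θ (.fn .u) = 1 := by
  rw [← incl_gen, ← incl_gen, ← map_mul, NCTorus.gen_uInv_u, map_one]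

theorem gen_v_vInv (θ : ℝ) : gen θ (.fn .v) * gen θ (.fn .vInv) = 1 := by
  rw [← incl_gen, ← incl_gen, ← map_mul, NCTorus.gen_v_vInv, map_one]

theorem gen_vInv_v (θ : ℝ) : gen θ (.fn .vInv) * gen θ (.fn .v) = 1 := by
  rw [← incl_gen, ← incl_gen, ← map_mul, NCTorus.gen_vInv_v, map_one]

theorem gen_comm (θ : ℝ) : gen θ (.fn .u) * gen θ (.fn .v) =
    Complex.exp (-(θ * Complex.I)) • (gen θ (.fn .v) * gen θ (.fn .u)) := by
  rw [← incl_gen, ← incl_gen, ← map_mul, NCTorus.gen_comm, map_smul, map_mul]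

/-- The conditions on the images of the generators of the algebra of forms under an algebra map. -/
structure LiftData (θ : ℝ) {C : Type*} [Ring C] [Algebra ℂ C] (f : TorusFormGen → C) : Prop where
  u_uInv : f (.fn .u) * f (.fn .uInv) = 1
  uInv_u : f (.fn .uInv) * f (.fn .u) = 1
  v_vInv : f (.fn .v) * f (.fn .vInv) = 1
  vInv_v : f (.fn .vInv) * f (.fn .v) = 1
  comm : f (.fn .u) * f (.fn .v) =
    Complex.exp (-(θ * Complex.I)) • (f (.fn .v) * f (.fn .u))
  du_u : f .du * f (.fn .u) = f (.fn .u) * f .du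
  dv_v : f .dv * f (.fn .v) = f (.fn .v) * f .dv
  du_v : f .du * f (.fn .v) = Complex.exp (-(θ * Complex.I)) • (f (.fn .v) * f .du)
  dv_u : f .dv * f (.fn .u) = Complex.exp (θ * Complex.I) • (f (.fn .u) * f .dv)
  du_du : f .du * f .du = 0
  dv_dv : f .dv * f .dv = 0
  du_dv : f .du * f .dv + Complex.exp (-(θ * Complex.I)) • (f .dv * f .du) = 0

/-- Algebra maps out of the algebra of forms. -/
noncomputable def lift {θ : ℝ} {C : Type*} [Ring C] [Algebra ℂ C] (f : TorusFormGen → C)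
    (h : LiftData θ f) : TorusForm θ →ₐ[ℂ] C :=
  RingQuot.liftAlgHom ℂ ⟨FreeAlgebra.lift ℂ f, by
    rintro _ _ (⟨_, _, h⟩ | _ | _ | _ | _ | _ | _ | _)
    · rcases h with _ | _ | _ | _ | _
      · simpa [TorusFormGen.incl] using h.u_uInv
      · simpa [TorusFormGen.incl] using h.uInv_u
      · simpa [TorusFormGen.incl] using h.v_vInv
      · simpa [TorusFormGen.incl] using h.vInv_v
      · simpa [TorusFormGen.incl] using h.comm
    · simpa using h.du_u
    · simpa using h.dv_v
    · simpa using h.du_v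
    · simpa using h.dv_u
    · simpa using h.du_du
    · simpa using h.dv_dv
    · simpa using h.du_dv⟩

theorem lift_gen {θ : ℝ} {C : Type*} [Ring C] [Algebra ℂ C] (f : TorusFormGen → C)
    (h : LiftData θ f) (g : TorusFormGen) : lift f h (gen θ g) = f g := by
  unfold lift gen
  exact (RingQuot.liftAlgHom_mkAlgHom_apply ℂ _ _ _).trans (by simp)

theorem induction {θ : ℝ} {P : TorusForm θ → Prop} (hc : ∀ c : ℂ, P (algebraMap ℂ _ c))
    (hg : ∀ g, P (gen θ g)) (ha : ∀ x y, P x → P y → P (x + y))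
    (hm : ∀ x y, P x → P y → P (x * y)) (x : TorusForm θ) : P x := by
  obtain ⟨y, rfl⟩ := RingQuot.mkAlgHom_surjective ℂ (TorusFormRel θ) x
  induction y using FreeAlgebra.induction with
  | grade0 r => rw [AlgHom.commutes]; exact hc r
  | grade1 g => exact hg g
  | mul a b h1 h2 => rw [map_mul]; exact hm _ _ h1 h2
  | add a b h1 h2 => rw [map_add]; exact ha _ _ h1 h2

end TorusForm

/-! ### Gradings -/

section Grading

variable {A Ω : Type} [Ring A] [Algebra ℂ A] [Ring Ω] [Algebra ℂ Ω]

theorem mem_formGrade_zero (i : A →ₐ[ℂ] Ω) (d : Ω →ₗ[ℂ] Ω) (a : A) : i a ∈ formGrade i d 0 := by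
  rw [formGrade, pow_zero, mul_one]
  exact ⟨a, rfl⟩

theorem mem_formGrade_one (i : A →ₐ[ℂ] Ω) (d : Ω →ₗ[ℂ] Ω) (a : A) : d (i a) ∈ formGrade i d 1 := by
  rw [formGrade, pow_one]
  have := Submodule.mul_mem_mul (LinearMap.mem_range_self i.toLinearMap 1)
    (LinearMap.mem_range_self (d ∘ₗ i.toLinearMap) a)
  simpa using this

/-- The Leibniz rule on elements of degree zero makes `formGrade` multiplicative. -/
theorem formGrade_gradedMonoid (i : A →ₐ[ℂ] Ω) (d : Ω →ₗ[ℂ] Ω)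
    (hd : ∀ a b, d (i a * i b) = i a * d (i b) + d (i a) * i b) :
    SetLike.GradedMonoid (formGrade i d) where
  one_mem := by simpa using mem_formGrade_zero i d 1
  mul_mem := by
    intro k l x y hx hy
    set R := LinearMap.range i.toLinearMap with hR
    set V := LinearMap.range (d ∘ₗ i.toLinearMap) with hV
    have hRR : R * R ≤ R := by
      rw [Submodule.mul_le]
      rintro _ ⟨a, rfl⟩ _ ⟨b, rfl⟩
      exact ⟨a * b, by simp⟩
    have h1 : (1 : Submodule ℂ Ω) ≤ R := by
      rw [Submodule.one_le]
      exact ⟨1, by simp⟩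
    have hVR : V * R ≤ R * V := by
      rw [Submodule.mul_le]
      rintro _ ⟨a, rfl⟩ _ ⟨b, rfl⟩
      have h2 : d (i a) * i b = 1 * d (i (a * b)) - i a * d (i b) := by
        rw [map_mul, hd, one_mul]; abel
      change d (i a) * i b ∈ _
      rw [h2]
      refine Submodule.sub_mem _ (Submodule.mul_mem_mul (h1 (Submodule.one_le.mp le_rfl)) ⟨_, rfl⟩)
        (Submodule.mul_mem_mul ⟨_, rfl⟩ ⟨_, rfl⟩)
    have hVk : ∀ k : ℕ, V ^ k * R ≤ R * V ^ k := by
      intro k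
      induction k with
      | zero => simp
      | succ k ih =>
        calc V ^ (k + 1) * R = V ^ k * (V * R) := by rw [pow_succ, mul_assoc]
          _ ≤ V ^ k * (R * V) := mul_le_mul_right hVR _
          _ = (V ^ k * R) * V := by rw [mul_assoc]
          _ ≤ (R * V ^ k) * V := mul_le_mul_left ih _
          _ = R * V ^ (k + 1) := by rw [mul_assoc, pow_succ]
    have h3 : (R * V ^ k) * (R * V ^ l) ≤ R * V ^ (k + l) := by
      calc (R * V ^ k) * (R * V ^ l) = R * (V ^ k * R) * V ^ l := by simp only [mul_assoc]
        _ ≤ R * (R * V ^ k) * V ^ l := mul_le_mul_left (mul_le_mul_right (hVk k) _) _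
        _ = (R * R) * (V ^ k * V ^ l) := by simp only [mul_assoc]
        _ ≤ R * (V ^ k * V ^ l) := mul_le_mul_left hRR _
        _ = _ := by rw [pow_add]
    exact h3 (Submodule.mul_mem_mul hx hy)

/-- A homogeneous element of the external direct sum. -/
noncomputable def homog (G : ℕ → Submodule ℂ Ω) (k : ℕ) (x : Ω) (h : x ∈ G k) : ⨁ k, G k :=
  DirectSum.of (fun k => G k) k ⟨x, h⟩

theorem homog_congr (G : ℕ → Submodule ℂ Ω) {k l : ℕ} {x y : Ω} (hx : x ∈ G k) (hy : y ∈ G l)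
    (hkl : k = l) (hxy : x = y) : homog G k x hx = homog G l y hy := by
  subst hkl hxy; rfl

theorem homog_mul (G : ℕ → Submodule ℂ Ω) [SetLike.GradedMonoid G] {k l : ℕ} {x y : Ω}
    (hx : x ∈ G k) (hy : y ∈ G l) :
    homog G k x hx * homog G l y hy = homog G (k + l) (x * y) (SetLike.mul_mem_graded hx hy) :=
  DirectSum.of_mul_of _ _

theorem homog_add (G : ℕ → Submodule ℂ Ω) {k : ℕ} {x y : Ω} (hx : x ∈ G k) (hy : y ∈ G k) :
    homog G k x hx + homog G k y hy = homog G k (x + y) (add_mem hx hy) :=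
  (map_add (DirectSum.of (fun k => G k) k) _ _).symm

theorem homog_smul (G : ℕ → Submodule ℂ Ω) {k : ℕ} {x : Ω} (hx : x ∈ G k) (c : ℂ) :
    c • homog G k x hx = homog G k (c • x) (Submodule.smul_mem _ c hx) :=
  ((DirectSum.lof ℂ ℕ (fun k => G k) k).map_smul c ⟨x, hx⟩).symm

theorem homog_zero (G : ℕ → Submodule ℂ Ω) {k : ℕ} {x : Ω} (hx : x ∈ G k) (h : x = 0) :
    homog G k x hx = 0 := by
  subst h
  exact map_zero (DirectSum.of (fun k => G k) k)

theorem homog_one (G : ℕ → Submodule ℂ Ω) [SetLike.GradedMonoid G] {k : ℕ} {x : Ω} (hx : x ∈ G k)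
    (hk : k = 0) (h : x = 1) : homog G k x hx = 1 := by
  subst hk h
  rfl

/-- The map `f` puts `x` in degree `k`. -/
def SentTo (G : ℕ → Submodule ℂ Ω) (f : Ω → ⨁ k, G k) (k : ℕ) (x : Ω) : Prop :=
  ∃ h : x ∈ G k, f x = homog G k x h

theorem SentTo.add {G : ℕ → Submodule ℂ Ω} [SetLike.GradedMonoid G] {f : Ω →ₐ[ℂ] ⨁ k, G k}
    {k : ℕ} {x y : Ω} (hx : SentTo G f k x) (hy : SentTo G f k y) : SentTo G f k (x + y) := by
  obtain ⟨hx, ex⟩ := hx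
  obtain ⟨hy, ey⟩ := hy
  exact ⟨add_mem hx hy, by rw [map_add, ex, ey, homog_add]⟩

theorem SentTo.smul {G : ℕ → Submodule ℂ Ω} [SetLike.GradedMonoid G] {f : Ω →ₐ[ℂ] ⨁ k, G k}
    {k : ℕ} {x : Ω} (hx : SentTo G f k x) (c : ℂ) : SentTo G f k (c • x) := by
  obtain ⟨hx, ex⟩ := hx
  exact ⟨Submodule.smul_mem _ c hx, by rw [map_smul, ex, homog_smul]⟩

theorem SentTo.neg {G : ℕ → Submodule ℂ Ω} [SetLike.GradedMonoid G] {f : Ω →ₐ[ℂ] ⨁ k, G k}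
    {k : ℕ} {x : Ω} (hx : SentTo G f k x) : SentTo G f k (-x) := by
  simpa using hx.smul (-1)

theorem SentTo.zero {G : ℕ → Submodule ℂ Ω} [SetLike.GradedMonoid G] {f : Ω →ₐ[ℂ] ⨁ k, G k}
    {k : ℕ} : SentTo G f k 0 :=
  ⟨zero_mem _, by rw [map_zero, homog_zero _ _ rfl]⟩

theorem SentTo.mul {G : ℕ → Submodule ℂ Ω} [SetLike.GradedMonoid G] {f : Ω →ₐ[ℂ] ⨁ k, G k}
    {k l m : ℕ} {x y : Ω} (hx : SentTo G f k x) (hy : SentTo G f l y) (h : k + l = m) :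
    SentTo G f m (x * y) := by
  obtain ⟨hx, ex⟩ := hx
  obtain ⟨hy, ey⟩ := hy
  subst h
  exact ⟨SetLike.mul_mem_graded hx hy, by rw [map_mul, ex, ey, homog_mul]⟩

theorem SentTo.algebraMap {G : ℕ → Submodule ℂ Ω} [SetLike.GradedMonoid G]
    {f : Ω →ₐ[ℂ] ⨁ k, G k} (c : ℂ) : SentTo G f 0 (algebraMap ℂ Ω c) := by
  have h : SentTo G f 0 1 := ⟨SetLike.GradedOne.one_mem, by rw [map_one, homog_one _ _ rfl rfl]⟩
  rw [Algebra.algebraMap_eq_smul_one]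
  exact h.smul c

/-- The grading by `formGrade`, from an algebra map sending `A` to degree 0 and `dA` to
degree 1. -/
@[reducible] noncomputable def formGradedAlgebra (i : A →ₐ[ℂ] Ω) (d : Ω →ₗ[ℂ] Ω)
    [SetLike.GradedMonoid (formGrade i d)] (f : Ω →ₐ[ℂ] ⨁ k, formGrade i d k)
    (hf : (DirectSum.coeAlgHom (formGrade i d)).comp f = AlgHom.id ℂ Ω)
    (h0 : ∀ a, SentTo _ f 0 (i a)) (h1 : ∀ a, SentTo _ f 1 (d (i a))) :
    GradedAlgebra (formGrade i d) :=
  GradedAlgebra.ofAlgHom _ f hf (by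
    have key : ∀ k, ∀ x ∈ LinearMap.range (d ∘ₗ i.toLinearMap) ^ k, SentTo _ f k x := by
      intro k x hx
      induction hx using Submodule.pow_induction_on_left' with
      | algebraMap r => exact SentTo.algebraMap r
      | add x y k hx hy ihx ihy => exact ihx.add ihy
      | mem_mul m hm k x hx ih =>
        obtain ⟨a, rfl⟩ := hm
        exact (h1 a).mul ih (add_comm _ _)
    rintro k ⟨x, hx⟩
    suffices h : SentTo _ f k x from h.2
    refine Submodule.mul_induction_on hx ?_ ?_
    · rintro _ ⟨a, rfl⟩ y hy
      exact (h0 a).mul (key k y hy) (zero_add _)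
    · rintro x y hx hy
      exact hx.add hy)

end Grading

/-! ### The differential on the forms of the torus -/

namespace TorusForm

/-- The differentials of the generators. -/
noncomputable def dGen (θ : ℝ) : TorusFormGen → TorusForm θ
  | .fn .u => gen θ .du
  | .fn .uInv => -(gen θ (.fn .uInv) * gen θ .du * gen θ (.fn .uInv))
  | .fn .v => gen θ .dv
  | .fn .vInv => -(gen θ (.fn .vInv) * gen θ .dv * gen θ (.fn .vInv))
  | .du => 0
  | .dv => 0

/-- The signs of the generators. -/
noncomputable def signGen (θ : ℝ) : TorusFormGen → TorusForm θ
  | .fn g => gen θ (.fn g)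
  | .du => -gen θ .du
  | .dv => -gen θ .dv

theorem gen_dv_du (θ : ℝ) : gen θ .du * gen θ .dv =
    -(Complex.exp (-(θ * Complex.I)) • (gen θ .dv * gen θ .du)) :=
  eq_neg_of_add_eq_zero_left (gen_du_dv θ)

theorem exp_mul_exp (θ : ℝ) :
    Complex.exp (-(θ * Complex.I)) * Complex.exp (θ * Complex.I) = 1 := by
  rw [← Complex.exp_add]; simp

theorem exp_mul_exp' (θ : ℝ) :
    Complex.exp (θ * Complex.I) * Complex.exp (-(θ * Complex.I)) = 1 := by
  rw [← Complex.exp_add]; simp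

theorem dHom_data (θ : ℝ) :
    LiftData θ (fun g => !![signGen θ g, dGen θ g; 0, gen θ g]) where
  u_uInv := by
    simp [signGen, dGen, Matrix.one_fin_two, ← mul_assoc, gen_u_uInv]
  uInv_u := by
    simp [signGen, dGen, Matrix.one_fin_two, mul_assoc, gen_uInv_u]
  v_vInv := by
    simp [signGen, dGen, Matrix.one_fin_two, ← mul_assoc, gen_v_vInv]
  vInv_v := by
    simp [signGen, dGen, Matrix.one_fin_two, mul_assoc, gen_vInv_v]
  comm := by
    simp [signGen, dGen, gen_comm, gen_dv_u, gen_du_v, smul_smul, exp_mul_exp, add_comm]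
  du_u := by
    simp [signGen, dGen, gen_du_u, gen_du_du]
  dv_v := by
    simp [signGen, dGen, gen_dv_v, gen_dv_dv]
  du_v := by
    simp [signGen, dGen, gen_du_v, gen_dv_du]
  dv_u := by
    simp [signGen, dGen, gen_dv_u, gen_dv_du, smul_smul, exp_mul_exp']
  du_du := by
    ext a b; fin_cases a <;> fin_cases b <;> simp [signGen, dGen, gen_du_du]
  dv_dv := by
    ext a b; fin_cases a <;> fin_cases b <;> simp [signGen, dGen, gen_dv_dv]
  du_dv := by
    ext a b; fin_cases a <;> fin_cases b <;> simp [signGen, dGen, gen_dv_du]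

/-- The algebra map `ω ↦ !![(-1)^|ω| ω, dω; 0, ω]`, which encodes the graded Leibniz rule. -/
noncomputable def dHom (θ : ℝ) : TorusForm θ →ₐ[ℂ] Matrix (Fin 2) (Fin 2) (TorusForm θ) :=
  lift _ (dHom_data θ)

/-- The differential on the forms of the torus: the graded derivation sending `u, v, du, dv` to
`du, dv, 0, 0`. -/
noncomputable def d (θ : ℝ) : TorusForm θ →ₗ[ℂ] TorusForm θ where
  toFun x := dHom θ x 0 1
  map_add' x y := by simp
  map_smul' c x := by simp

/-- The sign automorphism. -/
noncomputable def sgn (θ : ℝ) : TorusForm θ →ₗ[ℂ] TorusForm θ where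
  toFun x := dHom θ x 0 0
  map_add' x y := by simp
  map_smul' c x := by simp

theorem d_gen (θ : ℝ) (g : TorusFormGen) : d θ (gen θ g) = dGen θ g := by
  simp [d, dHom, lift_gen]

theorem sgn_gen (θ : ℝ) (g : TorusFormGen) : sgn θ (gen θ g) = signGen θ g := by
  simp [sgn, dHom, lift_gen]

theorem dHom_one (θ : ℝ) (x : TorusForm θ) : dHom θ x 1 0 = 0 ∧ dHom θ x 1 1 = x := by
  induction x using TorusForm.induction with
  | hc c => simp [Matrix.algebraMap_matrix_apply]
  | hg g => simp [dHom, lift_gen]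
  | ha x y hx hy => simp [hx, hy]
  | hm x y hx hy => simp [Matrix.mul_apply, hx, hy]

theorem sgn_mul (θ : ℝ) (x y : TorusForm θ) : sgn θ (x * y) = sgn θ x * sgn θ y := by
  simp [sgn, Matrix.mul_apply, dHom_one]

theorem d_mul (θ : ℝ) (x y : TorusForm θ) : d θ (x * y) = sgn θ x * d θ y + d θ x * y := by
  simp [sgn, d, Matrix.mul_apply, dHom_one]

theorem d_algebraMap (θ : ℝ) (c : ℂ) : d θ (algebraMap ℂ _ c) = 0 := by
  simp [d, Matrix.algebraMap_matrix_apply]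

theorem sgn_algebraMap (θ : ℝ) (c : ℂ) : sgn θ (algebraMap ℂ _ c) = algebraMap ℂ _ c := by
  simp [sgn, Matrix.algebraMap_matrix_apply]

theorem sgn_incl (θ : ℝ) (a : NCTorus θ) : sgn θ (incl θ a) = incl θ a := by
  induction a using NCTorus.induction with
  | hc c => simp [sgn_algebraMap]
  | hg g => simp [incl_gen, sgn_gen, signGen]
  | ha x y hx hy => simp [hx, hy]
  | hm x y hx hy => simp [hx, hy, sgn_mul]

theorem d_incl_mul (θ : ℝ) (a b : NCTorus θ) : d θ (incl θ a * incl θ b) =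
    incl θ a * d θ (incl θ b) + d θ (incl θ a) * incl θ b := by
  rw [d_mul, sgn_incl]

theorem d_d_aux (θ : ℝ) (x : TorusForm θ) :
    d θ (d θ x) = 0 ∧ d θ (sgn θ x) = -sgn θ (d θ x) ∧ sgn θ (sgn θ x) = x := by
  induction x using TorusForm.induction with
  | hc c => simp [d_algebraMap, sgn_algebraMap]
  | hg g =>
    rcases g with (_ | _ | _ | _) | _ | _ <;>
      simp [d_gen, dGen, signGen, sgn_gen, d_mul, sgn_mul, mul_assoc]
  | ha x y hx hy => simp [hx, hy, add_comm]
  | hm x y hx hy =>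
    obtain ⟨h1, h2, h3⟩ := hx
    obtain ⟨h4, h5, h6⟩ := hy
    refine ⟨?_, ?_, ?_⟩
    · simp [d_mul, h1, h2, h3, h4]
    · simp [d_mul, sgn_mul, h2, h5, h3, add_comm]
    · simp [sgn_mul, h3, h6]

theorem d_d (θ : ℝ) (x : TorusForm θ) : d θ (d θ x) = 0 := (d_d_aux θ x).1

theorem sgn_d_incl (θ : ℝ) (a : NCTorus θ) : sgn θ (d θ (incl θ a)) = -d θ (incl θ a) := by
  have := (d_d_aux θ (incl θ a)).2.1
  rw [sgn_incl] at this
  exact (neg_eq_iff_eq_neg.mpr this).symm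

/-- The space of `k`-forms on the torus, `span {a⁰ da¹ ∧ ⋯ ∧ daᵏ}`. -/
noncomputable abbrev grade (θ : ℝ) : ℕ → Submodule ℂ (TorusForm θ) := formGrade (incl θ) (d θ)

noncomputable instance (θ : ℝ) : SetLike.GradedMonoid (grade θ) :=
  formGrade_gradedMonoid _ _ (d_incl_mul θ)

theorem fn_mem (θ : ℝ) (g : TorusGen) : gen θ (.fn g) ∈ grade θ 0 := by
  rw [← incl_gen]; exact mem_formGrade_zero _ _ _

theorem du_mem (θ : ℝ) : gen θ .du ∈ grade θ 1 := by
  have := mem_formGrade_one (incl θ) (d θ) (NCTorus.gen θ .u)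
  rwa [incl_gen, d_gen] at this

theorem dv_mem (θ : ℝ) : gen θ .dv ∈ grade θ 1 := by
  have := mem_formGrade_one (incl θ) (d θ) (NCTorus.gen θ .v)
  rwa [incl_gen, d_gen] at this

/-- The degrees of the generators. -/
def deg : TorusFormGen → ℕ
  | .fn _ => 0
  | .du => 1
  | .dv => 1

theorem gen_mem (θ : ℝ) : ∀ g, gen θ g ∈ grade θ (deg g)
  | .fn g => fn_mem θ g
  | .du => du_mem θ
  | .dv => dv_mem θ

theorem gradeHom_data (θ : ℝ) :
    LiftData θ (fun g => homog (grade θ) (deg g) (gen θ g) (gen_mem θ g)) where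
  u_uInv := by rw [homog_mul]; exact homog_one _ _ rfl (gen_u_uInv θ)
  uInv_u := by rw [homog_mul]; exact homog_one _ _ rfl (gen_uInv_u θ)
  v_vInv := by rw [homog_mul]; exact homog_one _ _ rfl (gen_v_vInv θ)
  vInv_v := by rw [homog_mul]; exact homog_one _ _ rfl (gen_vInv_v θ)
  comm := by rw [homog_mul, homog_mul, homog_smul]; exact homog_congr _ _ _ rfl (gen_comm θ)
  du_u := by rw [homog_mul, homog_mul]; exact homog_congr _ _ _ rfl (gen_du_u θ)
  dv_v := by rw [homog_mul, homog_mul]; exact homog_congr _ _ _ rfl (gen_dv_v θ)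
  du_v := by rw [homog_mul, homog_mul, homog_smul]; exact homog_congr _ _ _ rfl (gen_du_v θ)
  dv_u := by rw [homog_mul, homog_mul, homog_smul]; exact homog_congr _ _ _ rfl (gen_dv_u θ)
  du_du := by rw [homog_mul]; exact homog_zero _ _ (gen_du_du θ)
  dv_dv := by rw [homog_mul]; exact homog_zero _ _ (gen_dv_dv θ)
  du_dv := by
    rw [homog_mul, homog_mul, homog_smul]
    exact (homog_add _ _ _).trans (homog_zero _ _ (gen_du_dv θ))

/-- The decomposition of forms into homogeneous components. -/
noncomputable def gradeHom (θ : ℝ) : TorusForm θ →ₐ[ℂ] ⨁ k, grade θ k :=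
  lift _ (gradeHom_data θ)

theorem gradeHom_gen (θ : ℝ) (g : TorusFormGen) :
    gradeHom θ (gen θ g) = homog (grade θ) (deg g) (gen θ g) (gen_mem θ g) :=
  lift_gen _ _ _

theorem gradeHom_spec (θ : ℝ) :
    (DirectSum.coeAlgHom (grade θ)).comp (gradeHom θ) = AlgHom.id ℂ (TorusForm θ) := by
  ext x
  induction x using TorusForm.induction with
  | hc c => simp only [AlgHom.commutes]
  | hg g =>
    rw [AlgHom.comp_apply, gradeHom_gen]
    exact DirectSum.coeAlgHom_of _ _ _
  | ha x y hx hy => rw [map_add, hx, hy, map_add]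
  | hm x y hx hy => rw [map_mul, hx, hy, map_mul]

theorem sentTo_gen (θ : ℝ) (g : TorusFormGen) :
    SentTo (grade θ) (gradeHom θ) (deg g) (gen θ g) :=
  ⟨gen_mem θ g, gradeHom_gen θ g⟩

theorem sentTo_incl (θ : ℝ) (a : NCTorus θ) :
    SentTo (grade θ) (gradeHom θ) 0 (incl θ a) ∧
      SentTo (grade θ) (gradeHom θ) 1 (d θ (incl θ a)) := by
  induction a using NCTorus.induction with
  | hc c =>
    rw [AlgHom.commutes, d_algebraMap]
    exact ⟨SentTo.algebraMap c, SentTo.zero⟩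
  | hg g =>
    rw [incl_gen, d_gen]
    refine ⟨sentTo_gen θ (.fn g), ?_⟩
    cases g with
    | u => exact sentTo_gen θ .du
    | v => exact sentTo_gen θ .dv
    | uInv =>
      have h0 : SentTo (grade θ) (gradeHom θ) 0 (gen θ (.fn .uInv)) := sentTo_gen θ (.fn .uInv)
      have h1 : SentTo (grade θ) (gradeHom θ) 1 (gen θ .du) := sentTo_gen θ .du
      rw [dGen]
      exact ((h0.mul h1 (zero_add 1)).mul h0 (add_zero 1)).neg
    | vInv =>
      have h0 : SentTo (grade θ) (gradeHom θ) 0 (gen θ (.fn .vInv)) := sentTo_gen θ (.fn .vInv)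
      have h1 : SentTo (grade θ) (gradeHom θ) 1 (gen θ .dv) := sentTo_gen θ .dv
      rw [dGen]
      exact ((h0.mul h1 (zero_add 1)).mul h0 (add_zero 1)).neg
  | ha x y hx hy =>
    rw [map_add, map_add]
    exact ⟨hx.1.add hy.1, hx.2.add hy.2⟩
  | hm x y hx hy =>
    rw [map_mul, d_incl_mul]
    exact ⟨hx.1.mul hy.1 (add_zero 0), (hx.1.mul hy.2 (zero_add 1)).add (hx.2.mul hy.1 (add_zero 1))⟩

noncomputable instance (θ : ℝ) : GradedAlgebra (grade θ) :=
  formGradedAlgebra _ _ (gradeHom θ) (gradeHom_spec θ) (fun a => (sentTo_incl θ a).1)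
    (fun a => (sentTo_incl θ a).2)

end TorusForm

/-! ### The calculus on `ℂ[t, t⁻¹]` -/

inductive CircleFormGen
  | t | tInv | dt

open CircleFormGen in
/-- The relations of the calculus on `ℂ[t, t⁻¹]`: `t` is invertible, it commutes with `dt`, and
`dt ∧ dt = 0` (which follows by differentiating `t dt = dt t`). -/
inductive CircleFormRel :
    FreeAlgebra ℂ CircleFormGen → FreeAlgebra ℂ CircleFormGen → Prop
  | t_tInv : CircleFormRel (FreeAlgebra.ι ℂ t * FreeAlgebra.ι ℂ tInv) 1
  | tInv_t : CircleFormRel (FreeAlgebra.ι ℂ tInv * FreeAlgebra.ι ℂ t) 1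
  | t_dt : CircleFormRel (FreeAlgebra.ι ℂ t * FreeAlgebra.ι ℂ dt)
      (FreeAlgebra.ι ℂ dt * FreeAlgebra.ι ℂ t)
  | tInv_dt : CircleFormRel (FreeAlgebra.ι ℂ tInv * FreeAlgebra.ι ℂ dt)
      (FreeAlgebra.ι ℂ dt * FreeAlgebra.ι ℂ tInv)
  | dt_dt : CircleFormRel (FreeAlgebra.ι ℂ dt * FreeAlgebra.ι ℂ dt) 0

/-- The algebra of differential forms on `ℂ[t, t⁻¹]`. -/
def CircleForm : Type := RingQuot CircleFormRel

noncomputable instance : Ring CircleForm := inferInstanceAs (Ring (RingQuot CircleFormRel))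

noncomputable instance : Algebra ℂ CircleForm :=
  inferInstanceAs (Algebra ℂ (RingQuot CircleFormRel))

namespace CircleForm

/-- The generators of the algebra of forms. -/
noncomputable def gen (g : CircleFormGen) : CircleForm :=
  RingQuot.mkAlgHom ℂ CircleFormRel (FreeAlgebra.ι ℂ g)

theorem gen_t_tInv : gen .t * gen .tInv = 1 := by
  have := RingQuot.mkAlgHom_rel ℂ CircleFormRel.t_tInv
  rwa [map_mul, map_one] at this

theorem gen_tInv_t : gen .tInv * gen .t = 1 := by
  have := RingQuot.mkAlgHom_rel ℂ CircleFormRel.tInv_t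
  rwa [map_mul, map_one] at this

theorem gen_t_dt : gen .t * gen .dt = gen .dt * gen .t := by
  have := RingQuot.mkAlgHom_rel ℂ CircleFormRel.t_dt
  rwa [map_mul, map_mul] at this

theorem gen_tInv_dt : gen .tInv * gen .dt = gen .dt * gen .tInv := by
  have := RingQuot.mkAlgHom_rel ℂ CircleFormRel.tInv_dt
  rwa [map_mul, map_mul] at this

theorem gen_dt_dt : gen .dt * gen .dt = 0 := by
  have := RingQuot.mkAlgHom_rel ℂ CircleFormRel.dt_dt
  rwa [map_mul, map_zero] at this

/-- The invertible element `t`. -/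
noncomputable def t : CircleFormˣ := ⟨gen .t, gen .tInv, gen_t_tInv, gen_tInv_t⟩

/-- The inclusion of `ℂ[t, t⁻¹]` as the algebra of 0-forms. -/
noncomputable def incl : ℂ[T;T⁻¹] →ₐ[ℂ] CircleForm :=
  AddMonoidAlgebra.lift ℂ CircleForm ℤ ((Units.coeHom CircleForm).comp (zpowersHom CircleFormˣ t))

theorem incl_T (n : ℤ) : incl (LaurentPolynomial.T n) = ((t ^ n : CircleFormˣ) : CircleForm) := by
  rw [incl, LaurentPolynomial.T, AddMonoidAlgebra.lift_single, one_smul]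
  rfl

theorem incl_T_one : incl (LaurentPolynomial.T 1) = gen .t := by
  rw [incl_T, zpow_one]; rfl

theorem incl_T_neg_one : incl (LaurentPolynomial.T (-1)) = gen .tInv := by
  rw [incl_T, zpow_neg_one]; rfl

/-- The conditions on the images of the generators of the algebra of forms under an algebra map. -/
structure LiftData {C : Type*} [Ring C] [Algebra ℂ C] (f : CircleFormGen → C) : Prop where
  t_tInv : f .t * f .tInv = 1
  tInv_t : f .tInv * f .t = 1
  t_dt : f .t * f .dt = f .dt * f .t
  tInv_dt : f .tInv * f .dt = f .dt * f .tInv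
  dt_dt : f .dt * f .dt = 0

/-- Algebra maps out of the algebra of forms. -/
noncomputable def lift {C : Type*} [Ring C] [Algebra ℂ C] (f : CircleFormGen → C)
    (h : LiftData f) : CircleForm →ₐ[ℂ] C :=
  RingQuot.liftAlgHom ℂ ⟨FreeAlgebra.lift ℂ f, by
    rintro _ _ (_ | _ | _ | _ | _)
    · simpa using h.t_tInv
    · simpa using h.tInv_t
    · simpa using h.t_dt
    · simpa using h.tInv_dt
    · simpa using h.dt_dt⟩

theorem lift_gen {C : Type*} [Ring C] [Algebra ℂ C] (f : CircleFormGen → C)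
    (h : LiftData f) (g : CircleFormGen) : lift f h (gen g) = f g := by
  unfold lift gen
  exact (RingQuot.liftAlgHom_mkAlgHom_apply ℂ _ _ _).trans (by simp)

theorem induction {P : CircleForm → Prop} (hc : ∀ c : ℂ, P (algebraMap ℂ _ c))
    (hg : ∀ g, P (gen g)) (ha : ∀ x y, P x → P y → P (x + y))
    (hm : ∀ x y, P x → P y → P (x * y)) (x : CircleForm) : P x := by
  obtain ⟨y, rfl⟩ := RingQuot.mkAlgHom_surjective ℂ CircleFormRel x
  induction y using FreeAlgebra.induction with
  | grade0 r => rw [AlgHom.commutes]; exact hc r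
  | grade1 g => exact hg g
  | mul a b h1 h2 => rw [map_mul]; exact hm _ _ h1 h2
  | add a b h1 h2 => rw [map_add]; exact ha _ _ h1 h2

theorem laurent_induction {P : ℂ[T;T⁻¹] → Prop} (hc : ∀ c : ℂ, P (algebraMap ℂ _ c))
    (h1 : P (LaurentPolynomial.T 1)) (h2 : P (LaurentPolynomial.T (-1)))
    (ha : ∀ x y, P x → P y → P (x + y)) (hm : ∀ x y, P x → P y → P (x * y)) (x : ℂ[T;T⁻¹]) :
    P x := by
  induction x using LaurentPolynomial.induction_on with
  | h_C a => exact hc a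
  | h_add hp hq => exact ha _ _ hp hq
  | h_C_mul_T n a h =>
    rw [LaurentPolynomial.T_add, ← mul_assoc]
    exact hm _ _ h h1
  | h_C_mul_T_Z n a h =>
    rw [sub_eq_add_neg, LaurentPolynomial.T_add, ← mul_assoc]
    exact hm _ _ h h2

/-- The differentials of the generators. -/
noncomputable def dGen : CircleFormGen → CircleForm
  | .t => gen .dt
  | .tInv => -(gen .tInv * gen .dt * gen .tInv)
  | .dt => 0

/-- The signs of the generators. -/
noncomputable def signGen : CircleFormGen → CircleForm
  | .t => gen .t
  | .tInv => gen .tInv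
  | .dt => -gen .dt

theorem dHom_data : LiftData (fun g => !![signGen g, dGen g; 0, gen g]) where
  t_tInv := by simp [signGen, dGen, Matrix.one_fin_two, ← mul_assoc, gen_t_tInv]
  tInv_t := by simp [signGen, dGen, Matrix.one_fin_two, mul_assoc, gen_tInv_t]
  t_dt := by simp [signGen, dGen, gen_t_dt, gen_dt_dt]
  tInv_dt := by
    have h (x : CircleForm) : gen .dt * (gen .dt * x) = 0 := by
      rw [← mul_assoc, gen_dt_dt, zero_mul]
    have h' : gen .dt * (gen .tInv * (gen .dt * gen .tInv)) = 0 := by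
      rw [← mul_assoc (gen .tInv), gen_tInv_dt, mul_assoc, h]
    ext a b; fin_cases a <;> fin_cases b <;> simp [signGen, dGen, gen_tInv_dt, mul_assoc, h, h']
  dt_dt := by
    ext a b; fin_cases a <;> fin_cases b <;> simp [signGen, dGen, gen_dt_dt]

/-- The algebra map `ω ↦ !![(-1)^|ω| ω, dω; 0, ω]`, which encodes the graded Leibniz rule. -/
noncomputable def dHom : CircleForm →ₐ[ℂ] Matrix (Fin 2) (Fin 2) CircleForm :=
  lift _ dHom_data

/-- The differential on the forms on `ℂ[t, t⁻¹]`: the graded derivation sending `t, dt` to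
`dt, 0`. -/
noncomputable def d : CircleForm →ₗ[ℂ] CircleForm where
  toFun x := dHom x 0 1
  map_add' x y := by simp
  map_smul' c x := by simp

/-- The sign automorphism. -/
noncomputable def sgn : CircleForm →ₗ[ℂ] CircleForm where
  toFun x := dHom x 0 0
  map_add' x y := by simp
  map_smul' c x := by simp

theorem d_gen (g : CircleFormGen) : d (gen g) = dGen g := by simp [d, dHom, lift_gen]

theorem sgn_gen (g : CircleFormGen) : sgn (gen g) = signGen g := by simp [sgn, dHom, lift_gen]

theorem dHom_one (x : CircleForm) : dHom x 1 0 = 0 ∧ dHom x 1 1 = x := by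
  induction x using CircleForm.induction with
  | hc c => simp [Matrix.algebraMap_matrix_apply]
  | hg g => simp [dHom, lift_gen]
  | ha x y hx hy => simp [hx, hy]
  | hm x y hx hy => simp [Matrix.mul_apply, hx, hy]

theorem sgn_mul (x y : CircleForm) : sgn (x * y) = sgn x * sgn y := by
  simp [sgn, Matrix.mul_apply, dHom_one]

theorem d_mul (x y : CircleForm) : d (x * y) = sgn x * d y + d x * y := by
  simp [sgn, d, Matrix.mul_apply, dHom_one]

theorem d_algebraMap (c : ℂ) : d (algebraMap ℂ _ c) = 0 := by
  simp [d, Matrix.algebraMap_matrix_apply]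

theorem sgn_algebraMap (c : ℂ) : sgn (algebraMap ℂ _ c) = algebraMap ℂ _ c := by
  simp [sgn, Matrix.algebraMap_matrix_apply]

theorem sgn_incl (a : ℂ[T;T⁻¹]) : sgn (incl a) = incl a := by
  induction a using laurent_induction with
  | hc c => rw [AlgHom.commutes, sgn_algebraMap]
  | h1 => rw [incl_T_one, sgn_gen, signGen]
  | h2 => rw [incl_T_neg_one, sgn_gen, signGen]
  | ha x y hx hy => simp [hx, hy]
  | hm x y hx hy => simp [hx, hy, sgn_mul]

theorem d_incl_mul (a b : ℂ[T;T⁻¹]) :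
    d (incl a * incl b) = incl a * d (incl b) + d (incl a) * incl b := by
  rw [d_mul, sgn_incl]

theorem d_d_aux (x : CircleForm) :
    d (d x) = 0 ∧ d (sgn x) = -sgn (d x) ∧ sgn (sgn x) = x := by
  induction x using CircleForm.induction with
  | hc c => simp [d_algebraMap, sgn_algebraMap]
  | hg g =>
    rcases g with _ | _ | _ <;>
      simp [d_gen, dGen, signGen, sgn_gen, d_mul, sgn_mul, mul_assoc]
  | ha x y hx hy => simp [hx, hy, add_comm]
  | hm x y hx hy =>
    obtain ⟨h1, h2, h3⟩ := hx
    obtain ⟨h4, h5, h6⟩ := hy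
    refine ⟨?_, ?_, ?_⟩
    · simp [d_mul, h1, h2, h3, h4]
    · simp [d_mul, sgn_mul, h2, h5, h3, add_comm]
    · simp [sgn_mul, h3, h6]

theorem d_d (x : CircleForm) : d (d x) = 0 := (d_d_aux x).1

theorem sgn_d_incl (a : ℂ[T;T⁻¹]) : sgn (d (incl a)) = -d (incl a) := by
  have := (d_d_aux (incl a)).2.1
  rw [sgn_incl] at this
  exact (neg_eq_iff_eq_neg.mpr this).symm

/-- The space of `k`-forms on `ℂ[t, t⁻¹]`, `span {h⁰ dh¹ ∧ ⋯ ∧ dhᵏ}`. -/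
noncomputable abbrev grade : ℕ → Submodule ℂ CircleForm := formGrade incl d

noncomputable instance : SetLike.GradedMonoid grade := formGrade_gradedMonoid _ _ d_incl_mul

/-- The degrees of the generators. -/
def deg : CircleFormGen → ℕ
  | .t => 0
  | .tInv => 0
  | .dt => 1

theorem gen_mem : ∀ g, gen g ∈ grade (deg g)
  | .t => incl_T_one ▸ mem_formGrade_zero _ _ _
  | .tInv => incl_T_neg_one ▸ mem_formGrade_zero _ _ _
  | .dt => by
    have := mem_formGrade_one incl d (LaurentPolynomial.T 1)
    rwa [incl_T_one, d_gen] at this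

theorem gradeHom_data : LiftData (fun g => homog grade (deg g) (gen g) (gen_mem g)) where
  t_tInv := by rw [homog_mul]; exact homog_one _ _ rfl gen_t_tInv
  tInv_t := by rw [homog_mul]; exact homog_one _ _ rfl gen_tInv_t
  t_dt := by rw [homog_mul, homog_mul]; exact homog_congr _ _ _ rfl gen_t_dt
  tInv_dt := by rw [homog_mul, homog_mul]; exact homog_congr _ _ _ rfl gen_tInv_dt
  dt_dt := by rw [homog_mul]; exact homog_zero _ _ gen_dt_dt

/-- The decomposition of forms into homogeneous components. -/
noncomputable def gradeHom : CircleForm →ₐ[ℂ] ⨁ k, grade k := lift _ gradeHom_data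

theorem sentTo_gen (g : CircleFormGen) : SentTo grade gradeHom (deg g) (gen g) :=
  ⟨gen_mem g, lift_gen _ _ _⟩

theorem gradeHom_spec :
    (DirectSum.coeAlgHom grade).comp gradeHom = AlgHom.id ℂ CircleForm := by
  ext x
  induction x using CircleForm.induction with
  | hc c => simp only [AlgHom.commutes]
  | hg g =>
    rw [AlgHom.comp_apply, (sentTo_gen g).2]
    exact DirectSum.coeAlgHom_of _ _ _
  | ha x y hx hy => rw [map_add, hx, hy, map_add]
  | hm x y hx hy => rw [map_mul, hx, hy, map_mul]

theorem sentTo_incl (a : ℂ[T;T⁻¹]) :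
    SentTo grade gradeHom 0 (incl a) ∧ SentTo grade gradeHom 1 (d (incl a)) := by
  have h0 : SentTo grade gradeHom 0 (gen .tInv) := sentTo_gen .tInv
  have h1 : SentTo grade gradeHom 1 (gen .dt) := sentTo_gen .dt
  induction a using laurent_induction with
  | hc c =>
    rw [AlgHom.commutes, d_algebraMap]
    exact ⟨SentTo.algebraMap c, SentTo.zero⟩
  | h1 =>
    rw [incl_T_one, d_gen]
    exact ⟨sentTo_gen .t, h1⟩
  | h2 =>
    rw [incl_T_neg_one, d_gen, dGen]
    exact ⟨h0, ((h0.mul h1 (zero_add 1)).mul h0 (add_zero 1)).neg⟩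
  | ha x y hx hy =>
    rw [map_add, map_add]
    exact ⟨hx.1.add hy.1, hx.2.add hy.2⟩
  | hm x y hx hy =>
    rw [map_mul, d_incl_mul]
    exact ⟨hx.1.mul hy.1 (add_zero 0),
      (hx.1.mul hy.2 (zero_add 1)).add (hx.2.mul hy.1 (add_zero 1))⟩

noncomputable instance : GradedAlgebra grade :=
  formGradedAlgebra _ _ gradeHom gradeHom_spec (fun a => (sentTo_incl a).1)
    (fun a => (sentTo_incl a).2)

end CircleForm

/-! ### The two calculi are differential calculi -/

section Calculus

variable {A Ω : Type} [Ring A] [Algebra ℂ A] [Ring Ω] [Algebra ℂ Ω]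

theorem gradeSign_of_mem (G : ℕ → Submodule ℂ Ω) [GradedAlgebra G] {k : ℕ} {x : Ω} (hx : x ∈ G k) :
    gradeSign G x = (-1 : ℂ) ^ k • x := by
  simp only [gradeSign, LinearMap.comp_apply, LinearEquiv.coe_coe,
    DirectSum.decomposeLinearEquiv_apply]
  rw [DirectSum.decompose_of_mem G hx, ← DirectSum.lof_eq_of ℂ, DirectSum.toModule_lof]
  rfl

theorem sgn_of_mem (i : A →ₐ[ℂ] Ω) (d sgn : Ω →ₗ[ℂ] Ω)
    (hs : ∀ x y, sgn (x * y) = sgn x * sgn y) (hsi : ∀ a, sgn (i a) = i a)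
    (hsd : ∀ a, sgn (d (i a)) = -d (i a)) (k : ℕ) :
    ∀ x ∈ formGrade i d k, sgn x = (-1 : ℂ) ^ k • x := by
  have key : ∀ x ∈ LinearMap.range (d ∘ₗ i.toLinearMap) ^ k, sgn x = (-1 : ℂ) ^ k • x := by
    intro x hx
    induction hx using Submodule.pow_induction_on_left' with
    | algebraMap r => simpa using hsi (algebraMap ℂ A r)
    | add x y k hx hy ihx ihy => rw [map_add, ihx, ihy, smul_add]
    | mem_mul m hm k x hx ih =>
      obtain ⟨a, rfl⟩ := hm
      change sgn (d (i a) * x) = _ • (d (i a) * x)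
      rw [hs, ih, hsd, pow_succ]
      simp
  intro x hx
  refine Submodule.mul_induction_on hx ?_ ?_
  · rintro _ ⟨a, rfl⟩ y hy
    change sgn (i a * y) = _ • (i a * y)
    rw [hs, hsi, key y hy, mul_smul_comm]
  · intro x y hx hy
    rw [map_add, hx, hy, smul_add]

theorem sgn_eq_gradeSign (i : A →ₐ[ℂ] Ω) (d sgn : Ω →ₗ[ℂ] Ω)
    (hs : ∀ x y, sgn (x * y) = sgn x * sgn y) (hsi : ∀ a, sgn (i a) = i a)
    (hsd : ∀ a, sgn (d (i a)) = -d (i a)) [GradedAlgebra (formGrade i d)] (x : Ω) :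
    sgn x = gradeSign (formGrade i d) x := by
  induction x using DirectSum.Decomposition.inductionOn (formGrade i d) with
  | zero => simp
  | homogeneous m => rw [gradeSign_of_mem _ m.2, sgn_of_mem i d sgn hs hsi hsd _ _ m.2]
  | add m n hm hn => rw [map_add, hm, hn, map_add]

theorem isDifferentialCalculus_formGrade (i : A →ₐ[ℂ] Ω) (d sgn : Ω →ₗ[ℂ] Ω)
    (hs : ∀ x y, sgn (x * y) = sgn x * sgn y) (hsi : ∀ a, sgn (i a) = i a)
    (hsd : ∀ a, sgn (d (i a)) = -d (i a)) (hd : ∀ x y, d (x * y) = sgn x * d y + d x * y)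
    (hdd : ∀ x, d (d x) = 0) (hi : Function.Injective i) [GradedAlgebra (formGrade i d)] :
    IsDifferentialCalculus i (formGrade i d) d where
  d_mem := by
    intro k x hx
    have h0 : ∀ l, ∀ x ∈ LinearMap.range (d ∘ₗ i.toLinearMap) ^ l, d x = 0 := by
      intro l x hx
      induction hx using Submodule.pow_induction_on_left' with
      | algebraMap r =>
        have h1 : d 1 = 0 := by
          have := hd 1 1
          have h2 := hsi 1
          rw [map_one] at h2
          rw [h2, mul_one, mul_one, one_mul] at this
          exact left_eq_add.mp this
        rw [Algebra.algebraMap_eq_smul_one, map_smul, h1, smul_zero]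
      | add x y k hx hy ihx ihy => rw [map_add, ihx, ihy, add_zero]
      | mem_mul m hm k x hx ih =>
        obtain ⟨a, rfl⟩ := hm
        change d (d (i a) * x) = 0
        rw [hd, ih, hdd, mul_zero, zero_mul, add_zero]
    refine Submodule.mul_induction_on hx ?_ ?_
    · rintro _ ⟨a, rfl⟩ y hy
      change d (i a * y) ∈ _
      rw [hd, h0 k y hy, mul_zero, zero_add, ← one_mul (d (i a) * y), ← map_one i, formGrade,
        pow_succ']
      exact Submodule.mul_mem_mul ⟨1, rfl⟩ (Submodule.mul_mem_mul ⟨a, rfl⟩ hy)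
    · intro x y hx hy
      rw [map_add]
      exact add_mem hx hy
  d_d := hdd
  leibniz := by
    intro k x hx y
    rw [hd, sgn_of_mem i d sgn hs hsi hsd k x hx, smul_mul_assoc, add_comm]
  injective := hi
  grade_zero := by rw [formGrade, pow_zero, mul_one]
  generated := fun _ => rfl

end Calculus

namespace TorusForm

theorem incl_injective (θ : ℝ) : Function.Injective (incl θ) := by
  let p : TorusForm θ →ₐ[ℂ] NCTorus θ := lift
    (fun
      | .fn g => NCTorus.gen θ g
      | .du => 0
      | .dv => 0)
    { u_uInv := NCTorus.gen_u_uInv θ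
      uInv_u := NCTorus.gen_uInv_u θ
      v_vInv := NCTorus.gen_v_vInv θ
      vInv_v := NCTorus.gen_vInv_v θ
      comm := NCTorus.gen_comm θ
      du_u := by simp
      dv_v := by simp
      du_v := by simp
      dv_u := by simp
      du_du := by simp
      dv_dv := by simp
      du_dv := by simp }
  have h : p.comp (incl θ) = AlgHom.id ℂ _ :=
    NCTorus.hom_ext fun g => by simp [p, incl_gen, lift_gen]
  exact Function.LeftInverse.injective (g := p) fun a => AlgHom.congr_fun h a

theorem isDifferentialCalculus (θ : ℝ) : IsDifferentialCalculus (incl θ) (grade θ) (d θ) :=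
  isDifferentialCalculus_formGrade _ _ (sgn θ) (sgn_mul θ) (sgn_incl θ) (sgn_d_incl θ) (d_mul θ)
    (d_d θ) (incl_injective θ)

theorem sgn_eq (θ : ℝ) (x : TorusForm θ) : gradeSign (grade θ) x = sgn θ x :=
  (sgn_eq_gradeSign _ _ (sgn θ) (sgn_mul θ) (sgn_incl θ) (sgn_d_incl θ) x).symm

end TorusForm

namespace CircleForm

theorem incl_injective : Function.Injective incl := by
  let p : CircleForm →ₐ[ℂ] ℂ[T;T⁻¹] := lift
    (fun
      | .t => LaurentPolynomial.T 1
      | .tInv => LaurentPolynomial.T (-1)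
      | .dt => 0)
    { t_tInv := by rw [← LaurentPolynomial.T_add]; rfl
      tInv_t := by rw [← LaurentPolynomial.T_add]; rfl
      t_dt := by simp
      tInv_dt := by simp
      dt_dt := by simp }
  refine Function.LeftInverse.injective (g := p) fun a => ?_
  induction a using laurent_induction with
  | hc c => rw [AlgHom.commutes, AlgHom.commutes]
  | h1 => rw [incl_T_one]; exact lift_gen _ _ _
  | h2 => rw [incl_T_neg_one]; exact lift_gen _ _ _
  | ha x y hx hy => rw [map_add, map_add, hx, hy]
  | hm x y hx hy => rw [map_mul, map_mul, hx, hy]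

theorem isDifferentialCalculus : IsDifferentialCalculus incl grade d :=
  isDifferentialCalculus_formGrade _ _ sgn sgn_mul sgn_incl sgn_d_incl d_mul d_d incl_injective

end CircleForm

/-! ### The coaction on forms -/

section Tensor

variable {ΩA ΩH : Type} [Ring ΩA] [Algebra ℂ ΩA] [Ring ΩH] [Algebra ℂ ΩH]
  (G : ℕ → Submodule ℂ ΩA) [GradedAlgebra G] (K : ℕ → Submodule ℂ ΩH) [GradedAlgebra K]

theorem gtmul_mul {j k : ℕ} (x : ΩA) {y : ΩH} (hy : y ∈ K j) {x' : ΩA} (hx : x' ∈ G k) (y' : ΩH) :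
    (x ᵍ⊗ₜ[ℂ] y * x' ᵍ⊗ₜ[ℂ] y' : G ᵍ⊗[ℂ] K) =
      (-1 : ℂ) ^ (j * k) • ((x * x') ᵍ⊗ₜ[ℂ] (y * y')) := by
  have := GradedTensorProduct.tmul_coe_mul_coe_tmul (R := ℂ) G K x ⟨y, hy⟩ ⟨x', hx⟩ y'
  rw [this]
  rcases Nat.even_or_odd (j * k) with h | h
  · simp [h.neg_one_pow]
  · simp [h.neg_one_pow]

theorem gtmul_add_left (x x' : ΩA) (y : ΩH) :
    ((x + x') ᵍ⊗ₜ[ℂ] y : G ᵍ⊗[ℂ] K) = x ᵍ⊗ₜ[ℂ] y + x' ᵍ⊗ₜ[ℂ] y := by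
  rw [GradedTensorProduct.tmul, TensorProduct.add_tmul, map_add]

theorem gtmul_add_right (x : ΩA) (y y' : ΩH) :
    (x ᵍ⊗ₜ[ℂ] (y + y') : G ᵍ⊗[ℂ] K) = x ᵍ⊗ₜ[ℂ] y + x ᵍ⊗ₜ[ℂ] y' := by
  rw [GradedTensorProduct.tmul, TensorProduct.tmul_add, map_add]

theorem gtmul_mul_left (x : ΩA) {y : ΩH} (hy : y ∈ K 0) (x' : ΩA) (y' : ΩH) :
    (x ᵍ⊗ₜ[ℂ] y * x' ᵍ⊗ₜ[ℂ] y' : G ᵍ⊗[ℂ] K) = (x * x') ᵍ⊗ₜ[ℂ] (y * y') := by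
  induction x' using DirectSum.Decomposition.inductionOn G with
  | zero => simp [GradedTensorProduct.tmul]
  | homogeneous m => rw [gtmul_mul G K x hy m.2, zero_mul, pow_zero, one_smul]
  | add m n hm hn =>
    rw [gtmul_add_left, mul_add, hm, hn, mul_add, gtmul_add_left]

theorem gtmul_mul_right (x : ΩA) (y : ΩH) {x' : ΩA} (hx : x' ∈ G 0) (y' : ΩH) :
    (x ᵍ⊗ₜ[ℂ] y * x' ᵍ⊗ₜ[ℂ] y' : G ᵍ⊗[ℂ] K) = (x * x') ᵍ⊗ₜ[ℂ] (y * y') := by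
  induction y using DirectSum.Decomposition.inductionOn K with
  | zero => simp [GradedTensorProduct.tmul]
  | homogeneous m => rw [gtmul_mul G K x m.2 hx, mul_zero, pow_zero, one_smul]
  | add m n hm hn =>
    rw [gtmul_add_right, add_mul, hm, hn, add_mul, gtmul_add_right]

theorem gtmul_mul_one_one (x : ΩA) {y : ΩH} (hy : y ∈ K 1) {x' : ΩA} (hx : x' ∈ G 1) (y' : ΩH) :
    (x ᵍ⊗ₜ[ℂ] y * x' ᵍ⊗ₜ[ℂ] y' : G ᵍ⊗[ℂ] K) = -((x * x') ᵍ⊗ₜ[ℂ] (y * y')) := by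
  rw [gtmul_mul G K x hy hx]; simp

/-- The sign map of the graded tensor product. -/
noncomputable def tensorSign : (G ᵍ⊗[ℂ] K) →ₗ[ℂ] (G ᵍ⊗[ℂ] K) :=
  (GradedTensorProduct.of ℂ G K).toLinearMap ∘ₗ
    TensorProduct.map (gradeSign G) (gradeSign K) ∘ₗ
      (GradedTensorProduct.of ℂ G K).symm.toLinearMap

theorem tensorSign_tmul (x : ΩA) (y : ΩH) :
    tensorSign G K (x ᵍ⊗ₜ[ℂ] y) = gradeSign G x ᵍ⊗ₜ[ℂ] gradeSign K y := rfl

theorem tensorD_tmul (d : ΩA →ₗ[ℂ] ΩA) (e : ΩH →ₗ[ℂ] ΩH) (x : ΩA) (y : ΩH) :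
    tensorD G d K e (x ᵍ⊗ₜ[ℂ] y) = d x ᵍ⊗ₜ[ℂ] y + gradeSign G x ᵍ⊗ₜ[ℂ] e y := rfl

theorem gtensor_induction {P : (G ᵍ⊗[ℂ] K) → Prop} (h0 : P 0)
    (ht : ∀ m n, ∀ x ∈ G m, ∀ y ∈ K n, P (x ᵍ⊗ₜ[ℂ] y)) (ha : ∀ x y, P x → P y → P (x + y))
    (z : G ᵍ⊗[ℂ] K) : P z := by
  obtain ⟨z, rfl⟩ := (GradedTensorProduct.of ℂ G K).surjective z
  induction z with
  | zero => rwa [map_zero]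
  | add x y hx hy => rw [map_add]; exact ha _ _ hx hy
  | tmul x y =>
    induction x using DirectSum.Decomposition.inductionOn G with
    | zero => rwa [TensorProduct.zero_tmul, map_zero]
    | add m n hm hn => rw [TensorProduct.add_tmul, map_add]; exact ha _ _ hm hn
    | homogeneous m =>
      induction y using DirectSum.Decomposition.inductionOn K with
      | zero => rwa [TensorProduct.tmul_zero, map_zero]
      | add m n hm hn => rw [TensorProduct.tmul_add, map_add]; exact ha _ _ hm hn
      | homogeneous n => exact ht _ _ _ m.2 _ n.2

theorem gtmul_smul_smul (a b : ℂ) (x : ΩA) (y : ΩH) :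
    ((a • x) ᵍ⊗ₜ[ℂ] (b • y) : G ᵍ⊗[ℂ] K) = (a * b) • (x ᵍ⊗ₜ[ℂ] y) := by
  rw [GradedTensorProduct.tmul, TensorProduct.smul_tmul_smul, map_smul]

theorem gtmul_smul_left (a : ℂ) (x : ΩA) (y : ΩH) :
    ((a • x) ᵍ⊗ₜ[ℂ] y : G ᵍ⊗[ℂ] K) = a • (x ᵍ⊗ₜ[ℂ] y) := by
  simpa using gtmul_smul_smul G K a 1 x y

theorem gtmul_smul_right (a : ℂ) (x : ΩA) (y : ΩH) :
    (x ᵍ⊗ₜ[ℂ] (a • y) : G ᵍ⊗[ℂ] K) = a • (x ᵍ⊗ₜ[ℂ] y) := by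
  simpa using gtmul_smul_smul G K 1 a x y

theorem gtmul_neg_right (x : ΩA) (y : ΩH) :
    (x ᵍ⊗ₜ[ℂ] (-y) : G ᵍ⊗[ℂ] K) = -(x ᵍ⊗ₜ[ℂ] y) := by
  simpa using gtmul_smul_right G K (-1) x y

theorem gtmul_neg_left (x : ΩA) (y : ΩH) :
    ((-x) ᵍ⊗ₜ[ℂ] y : G ᵍ⊗[ℂ] K) = -(x ᵍ⊗ₜ[ℂ] y) := by
  simpa using gtmul_smul_left G K (-1) x y

theorem gtmul_zero_right (x : ΩA) : (x ᵍ⊗ₜ[ℂ] (0 : ΩH) : G ᵍ⊗[ℂ] K) = 0 := by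
  simp [GradedTensorProduct.tmul]

theorem gtmul_zero_left (y : ΩH) : ((0 : ΩA) ᵍ⊗ₜ[ℂ] y : G ᵍ⊗[ℂ] K) = 0 := by
  simp [GradedTensorProduct.tmul]

theorem tensorSign_mul (x y : G ᵍ⊗[ℂ] K) :
    tensorSign G K (x * y) = tensorSign G K x * tensorSign G K y := by
  induction x using gtensor_induction with
  | h0 => simp
  | ha x x' hx hx' => rw [add_mul, map_add, hx, hx', map_add, add_mul]
  | ht m n a ha b hb =>
    induction y using gtensor_induction with
    | h0 => simp
    | ha x x' hx hx' => rw [mul_add, map_add, hx, hx', map_add, mul_add]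
    | ht m' n' a' ha' b' hb' =>
      rw [gtmul_mul G K a hb ha', map_smul, tensorSign_tmul, tensorSign_tmul, tensorSign_tmul,
        gradeSign_of_mem G ha, gradeSign_of_mem G ha', gradeSign_of_mem K hb,
        gradeSign_of_mem K hb', gradeSign_of_mem G (SetLike.mul_mem_graded ha ha'),
        gradeSign_of_mem K (SetLike.mul_mem_graded hb hb'), gtmul_smul_smul, gtmul_smul_smul,
        gtmul_smul_smul, smul_mul_assoc, mul_smul_comm, gtmul_mul G K a hb ha']
      simp only [smul_smul]
      congr 1
      ring

theorem tensorD_mul {d : ΩA →ₗ[ℂ] ΩA} {e : ΩH →ₗ[ℂ] ΩH} (hd : IsDGAlgebra G d)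
    (he : IsDGAlgebra K e) (x y : G ᵍ⊗[ℂ] K) :
    tensorD G d K e (x * y) =
      tensorSign G K x * tensorD G d K e y + tensorD G d K e x * y := by
  induction x using gtensor_induction with
  | h0 => simp
  | ha x x' hx hx' =>
    rw [add_mul, map_add, hx, hx', map_add, map_add, add_mul, add_mul]; abel
  | ht m n a ha b hb =>
    induction y using gtensor_induction with
    | h0 => simp
    | ha x x' hx hx' => rw [mul_add, map_add, hx, hx', map_add, mul_add, mul_add]; abel
    | ht m' n' a' ha' b' hb' =>
      have e1 := gtmul_mul G K a hb ha' b'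
      rw [e1, map_smul, tensorD_tmul, tensorD_tmul, tensorD_tmul, tensorSign_tmul,
        gradeSign_of_mem G ha, gradeSign_of_mem G ha', gradeSign_of_mem K hb,
        gradeSign_of_mem G (SetLike.mul_mem_graded ha ha'), hd.leibniz m a ha, he.leibniz n b hb,
        gtmul_smul_smul, mul_add, add_mul, gtmul_smul_left, gtmul_smul_left, gtmul_smul_left,
        smul_mul_assoc, smul_mul_assoc, smul_mul_assoc, mul_smul_comm,
        gtmul_mul G K a hb (hd.d_mem _ _ ha'), gtmul_mul G K a hb ha',
        gtmul_mul G K (d a) hb ha', gtmul_mul G K a (he.d_mem _ _ hb) ha', gtmul_add_left,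
        gtmul_add_right, gtmul_smul_left, gtmul_smul_right]
      rcases Nat.even_or_odd m with hm | hm <;> rcases Nat.even_or_odd n with hn | hn <;>
        rcases Nat.even_or_odd m' with hm' | hm' <;>
        simp [pow_add, pow_mul, mul_add, hm.neg_one_pow, hn.neg_one_pow, hm'.neg_one_pow] <;> abel

theorem tmul_mem_tensorGrade {m n k : ℕ} {x : ΩA} {y : ΩH} (hx : x ∈ G m) (hy : y ∈ K n)
    (h : m + n = k) : x ᵍ⊗ₜ[ℂ] y ∈ tensorGrade G K k :=
  Submodule.subset_span ⟨m, n, h, x, hx, y, hy, rfl⟩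

theorem tensorGrade_mul {k l : ℕ} {x y : G ᵍ⊗[ℂ] K} (hx : x ∈ tensorGrade G K k)
    (hy : y ∈ tensorGrade G K l) : x * y ∈ tensorGrade G K (k + l) := by
  induction hx using Submodule.span_induction with
  | zero => rw [zero_mul]; exact zero_mem _
  | add x x' _ _ h h' => rw [add_mul]; exact add_mem h h'
  | smul c x _ h => rw [smul_mul_assoc]; exact Submodule.smul_mem _ c h
  | mem x hx =>
    obtain ⟨m, n, rfl, a, ha, b, hb, rfl⟩ := hx
    induction hy using Submodule.span_induction with
    | zero => rw [mul_zero]; exact zero_mem _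
    | add x x' _ _ h h' => rw [mul_add]; exact add_mem h h'
    | smul c x _ h => rw [mul_smul_comm]; exact Submodule.smul_mem _ c h
    | mem x hx =>
      obtain ⟨m', n', rfl, a', ha', b', hb', rfl⟩ := hx
      rw [gtmul_mul G K a hb ha']
      exact Submodule.smul_mem _ _ (tmul_mem_tensorGrade G K (SetLike.mul_mem_graded ha ha')
        (SetLike.mul_mem_graded hb hb') (by ring))

theorem tensorD_mem {d : ΩA →ₗ[ℂ] ΩA} {e : ΩH →ₗ[ℂ] ΩH} (hd : IsDGAlgebra G d)
    (he : IsDGAlgebra K e) {k : ℕ} {x : G ᵍ⊗[ℂ] K} (hx : x ∈ tensorGrade G K k) :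
    tensorD G d K e x ∈ tensorGrade G K (k + 1) := by
  induction hx using Submodule.span_induction with
  | zero => rw [map_zero]; exact zero_mem _
  | add x x' _ _ h h' => rw [map_add]; exact add_mem h h'
  | smul c x _ h => rw [map_smul]; exact Submodule.smul_mem _ c h
  | mem x hx =>
    obtain ⟨m, n, rfl, a, ha, b, hb, rfl⟩ := hx
    rw [tensorD_tmul, gradeSign_of_mem G ha, gtmul_smul_left]
    exact add_mem (tmul_mem_tensorGrade G K (hd.d_mem _ _ ha) hb (by ring))
      (Submodule.smul_mem _ _ (tmul_mem_tensorGrade G K ha (he.d_mem _ _ hb) (by ring)))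

end Tensor

namespace CircleForm

theorem t_mem : gen .t ∈ grade 0 := gen_mem .t

theorem tInv_mem : gen .tInv ∈ grade 0 := gen_mem .tInv

theorem dt_mem : gen .dt ∈ grade 1 := gen_mem .dt

theorem dtInv_mem : dGen .tInv ∈ grade 1 := by
  rw [← d_gen]
  exact isDifferentialCalculus.d_mem 0 _ tInv_mem

end CircleForm

namespace TorusForm

theorem uu_mem (θ : ℝ) (g : TorusGen) : gen θ (.fn g) ∈ grade θ 0 := fn_mem θ g

/-- The values of the coaction on the generators: `u ↦ u ⊗ t`, `v ↦ v ⊗ t⁻¹`,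
`du ↦ du ⊗ t + u ⊗ dt`, `dv ↦ dv ⊗ t⁻¹ + v ⊗ d(t⁻¹)`. -/
noncomputable def coactionGen (θ : ℝ) : TorusFormGen → grade θ ᵍ⊗[ℂ] CircleForm.grade
  | .fn .u => gen θ (.fn .u) ᵍ⊗ₜ[ℂ] CircleForm.gen .t
  | .fn .uInv => gen θ (.fn .uInv) ᵍ⊗ₜ[ℂ] CircleForm.gen .tInv
  | .fn .v => gen θ (.fn .v) ᵍ⊗ₜ[ℂ] CircleForm.gen .tInv
  | .fn .vInv => gen θ (.fn .vInv) ᵍ⊗ₜ[ℂ] CircleForm.gen .t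
  | .du => gen θ .du ᵍ⊗ₜ[ℂ] CircleForm.gen .t + gen θ (.fn .u) ᵍ⊗ₜ[ℂ] CircleForm.gen .dt
  | .dv => gen θ .dv ᵍ⊗ₜ[ℂ] CircleForm.gen .tInv + gen θ (.fn .v) ᵍ⊗ₜ[ℂ] CircleForm.dGen .tInv

end TorusForm

namespace CircleForm

theorem sgn_eq (x : CircleForm) : gradeSign grade x = sgn x :=
  (sgn_eq_gradeSign _ _ sgn sgn_mul sgn_incl sgn_d_incl x).symm

theorem dGen_tInv_mul_t : dGen .tInv * gen .t = -(gen .tInv * gen .dt) := by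
  rw [dGen, neg_mul, mul_assoc, gen_tInv_t, mul_one]

theorem t_mul_dGen_tInv : gen .t * dGen .tInv = -(gen .tInv * gen .dt) := by
  rw [dGen, mul_neg, ← mul_assoc, ← mul_assoc, gen_t_tInv, one_mul, gen_tInv_dt]

theorem dGen_tInv_mul_tInv : dGen .tInv * gen .tInv = gen .tInv * dGen .tInv := by
  rw [dGen, neg_mul, mul_neg, mul_assoc (gen .tInv) (gen .dt) (gen .tInv), ← gen_tInv_dt, mul_assoc,
    mul_assoc, ← gen_tInv_dt]

theorem dGen_tInv_mul_dt : dGen .tInv * gen .dt = 0 := by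
  rw [dGen, neg_mul, mul_assoc, gen_tInv_dt, ← mul_assoc, mul_assoc (gen .dt), gen_tInv_dt,
    ← mul_assoc, gen_dt_dt, zero_mul, zero_mul, neg_zero]

theorem dt_mul_dGen_tInv : gen .dt * dGen .tInv = 0 := by
  rw [dGen, gen_tInv_dt, mul_neg, ← mul_assoc, ← mul_assoc, gen_dt_dt, zero_mul, zero_mul, neg_zero]

theorem t_mul_dGen_tInv_mul_t : gen .t * dGen .tInv * gen .t = -gen .dt := by
  rw [mul_assoc, dGen_tInv_mul_t, mul_neg, ← mul_assoc, gen_t_tInv, one_mul]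

theorem dGen_tInv_mul_dGen_tInv : dGen .tInv * dGen .tInv = 0 := by
  nth_rw 2 [dGen]
  rw [mul_neg, ← mul_assoc, ← mul_assoc, dGen_tInv_mul_tInv, mul_assoc (gen .tInv),
    dGen_tInv_mul_dt, mul_zero, zero_mul, neg_zero]

end CircleForm

namespace TorusForm

theorem coaction_data (θ : ℝ) : LiftData θ (coactionGen θ) where
  u_uInv := by
    simp only [coactionGen]
    rw [gtmul_mul_left _ _ _ CircleForm.t_mem, gen_u_uInv, CircleForm.gen_t_tInv]; rfl
  uInv_u := by
    simp only [coactionGen]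
    rw [gtmul_mul_left _ _ _ CircleForm.tInv_mem, gen_uInv_u, CircleForm.gen_tInv_t]; rfl
  v_vInv := by
    simp only [coactionGen]
    rw [gtmul_mul_left _ _ _ CircleForm.tInv_mem, gen_v_vInv, CircleForm.gen_tInv_t]; rfl
  vInv_v := by
    simp only [coactionGen]
    rw [gtmul_mul_left _ _ _ CircleForm.t_mem, gen_vInv_v, CircleForm.gen_t_tInv]; rfl
  comm := by
    simp only [coactionGen]
    rw [gtmul_mul_left _ _ _ CircleForm.t_mem, gtmul_mul_left _ _ _ CircleForm.tInv_mem,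
      gen_comm, CircleForm.gen_tInv_t, CircleForm.gen_t_tInv, gtmul_smul_left]
  du_u := by
    simp only [coactionGen]
    simp only [mul_add, add_mul, gtmul_mul_left _ _ _ CircleForm.t_mem,
      gtmul_mul_right _ _ _ _ (uu_mem θ _), gen_du_u, CircleForm.gen_t_dt]
  dv_v := by
    simp only [coactionGen]
    simp only [mul_add, add_mul, gtmul_mul_left _ _ _ CircleForm.tInv_mem,
      gtmul_mul_right _ _ _ _ (uu_mem θ _), gen_dv_v, CircleForm.dGen_tInv_mul_tInv]
  du_v := by
    simp only [coactionGen]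
    simp only [mul_add, add_mul, gtmul_mul_left _ _ _ CircleForm.t_mem,
      gtmul_mul_left _ _ _ CircleForm.tInv_mem, CircleForm.gen_t_tInv, CircleForm.gen_tInv_t,
      gtmul_mul_right _ _ _ _ (uu_mem θ _), gen_du_v, gen_comm, CircleForm.gen_tInv_dt,
      gtmul_smul_left, smul_add]
  dv_u := by
    have h : gen θ (.fn .v) * gen θ (.fn .u) =
        Complex.exp (θ * Complex.I) • (gen θ (.fn .u) * gen θ (.fn .v)) := by
      rw [gen_comm, smul_smul, exp_mul_exp', one_smul]
    simp only [coactionGen]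
    simp only [mul_add, add_mul, gtmul_mul_left _ _ _ CircleForm.t_mem,
      gtmul_mul_left _ _ _ CircleForm.tInv_mem, CircleForm.gen_t_tInv, CircleForm.gen_tInv_t,
      gtmul_mul_right _ _ _ _ (uu_mem θ _), gen_dv_u, h, CircleForm.dGen_tInv_mul_t,
      CircleForm.t_mul_dGen_tInv, gtmul_smul_left, smul_add]
  du_du := by
    simp only [coactionGen]
    simp only [mul_add, add_mul, gtmul_mul_left _ _ _ CircleForm.t_mem,
      gtmul_mul_one_one _ _ _ CircleForm.dt_mem (du_mem θ),
      gtmul_mul_right _ _ _ _ (uu_mem θ _), gen_du_du, gen_du_u, CircleForm.gen_t_dt,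
      CircleForm.gen_dt_dt, gtmul_zero_left, gtmul_zero_right]
    abel
  dv_dv := by
    simp only [coactionGen]
    simp only [mul_add, add_mul, gtmul_mul_left _ _ _ CircleForm.tInv_mem,
      gtmul_mul_one_one _ _ _ CircleForm.dtInv_mem (dv_mem θ),
      gtmul_mul_right _ _ _ _ (uu_mem θ _), gen_dv_dv, gen_dv_v, CircleForm.dGen_tInv_mul_tInv,
      CircleForm.dGen_tInv_mul_dGen_tInv, gtmul_zero_left, gtmul_zero_right]
    abel
  du_dv := by
    simp only [coactionGen]
    simp only [mul_add, add_mul, gtmul_mul_left _ _ _ CircleForm.t_mem,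
      gtmul_mul_left _ _ _ CircleForm.tInv_mem,
      gtmul_mul_one_one _ _ _ CircleForm.dt_mem (dv_mem θ),
      gtmul_mul_one_one _ _ _ CircleForm.dtInv_mem (du_mem θ),
      gtmul_mul_right _ _ _ _ (uu_mem θ _), gen_dv_du, gen_du_v, gen_dv_u,
      CircleForm.dGen_tInv_mul_t, CircleForm.t_mul_dGen_tInv, ← CircleForm.gen_tInv_dt,
      CircleForm.gen_t_tInv, CircleForm.gen_tInv_t,
      CircleForm.dGen_tInv_mul_dt, CircleForm.dt_mul_dGen_tInv, gtmul_zero_right,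
      gtmul_neg_left, gtmul_neg_right, gtmul_smul_left, smul_add, smul_neg, smul_smul,
      exp_mul_exp, one_smul, smul_zero]
    abel

/-- The morphism `Δ : Ω(A) → Ω(A) ⊗ Ω(H)` of differential graded algebras extending the coaction,
with values in the graded tensor product. -/
noncomputable def coaction (θ : ℝ) : TorusForm θ →ₐ[ℂ] grade θ ᵍ⊗[ℂ] CircleForm.grade :=
  lift _ (coaction_data θ)

theorem coaction_gen (θ : ℝ) (g : TorusFormGen) : coaction θ (gen θ g) = coactionGen θ g :=
  lift_gen _ _ _

theorem coaction_incl_gen (θ : ℝ) (g : TorusGen) : coaction θ (incl θ (NCTorus.gen θ g)) =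
    GradedTensorProduct.of ℂ (grade θ) CircleForm.grade
      (TensorProduct.map (incl θ).toLinearMap CircleForm.incl.toLinearMap
        (torusCoaction θ (NCTorus.gen θ g))) := by
  rw [incl_gen, coaction_gen, torusCoaction, NCTorus.lift_gen]
  rcases g with _ | _ | _ | _ <;>
    simp [coactionGen, incl_gen, CircleForm.incl_T_one, CircleForm.incl_T_neg_one,
      GradedTensorProduct.tmul]

theorem map_incl_mul (θ : ℝ) (x y : NCTorus θ ⊗[ℂ] ℂ[T;T⁻¹]) :
    GradedTensorProduct.of ℂ (grade θ) CircleForm.grade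
      (TensorProduct.map (incl θ).toLinearMap CircleForm.incl.toLinearMap (x * y)) =
    GradedTensorProduct.of ℂ (grade θ) CircleForm.grade
      (TensorProduct.map (incl θ).toLinearMap CircleForm.incl.toLinearMap x) *
    GradedTensorProduct.of ℂ (grade θ) CircleForm.grade
      (TensorProduct.map (incl θ).toLinearMap CircleForm.incl.toLinearMap y) := by
  induction x with
  | zero => simp
  | add x x' hx hx' => rw [add_mul, map_add, map_add, hx, hx', map_add, map_add, add_mul]
  | tmul a p =>
    induction y with
    | zero => simp
    | add x x' hx hx' => rw [mul_add, map_add, map_add, hx, hx', map_add, map_add, mul_add]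
    | tmul b q =>
      have h := gtmul_mul_left (grade θ) CircleForm.grade (incl θ a)
        (mem_formGrade_zero CircleForm.incl CircleForm.d p) (incl θ b) (CircleForm.incl q)
      rw [← map_mul (incl θ), ← map_mul CircleForm.incl] at h
      rw [Algebra.TensorProduct.tmul_mul_tmul]
      exact h.symm

theorem coaction_incl (θ : ℝ) (a : NCTorus θ) : coaction θ (incl θ a) =
    GradedTensorProduct.of ℂ (grade θ) CircleForm.grade
      (TensorProduct.map (incl θ).toLinearMap CircleForm.incl.toLinearMap
        (torusCoaction θ a)) := by
  induction a using NCTorus.induction with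
  | hc c =>
    rw [AlgHom.commutes, AlgHom.commutes, AlgHom.commutes, Algebra.algebraMap_eq_smul_one,
      Algebra.algebraMap_eq_smul_one, map_smul, map_smul, Algebra.TensorProduct.one_def,
      TensorProduct.map_tmul, AlgHom.toLinearMap_apply, AlgHom.toLinearMap_apply, map_one, map_one]
    rfl
  | hg g => exact coaction_incl_gen θ g
  | ha x y hx hy => simp only [map_add, hx, hy]
  | hm x y hx hy => rw [map_mul, map_mul, hx, hy, map_mul, map_incl_mul]

theorem coaction_d_aux (θ : ℝ) (x : TorusForm θ) :
    coaction θ (d θ x) = tensorD (grade θ) (d θ) CircleForm.grade CircleForm.d (coaction θ x) ∧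
      coaction θ (sgn θ x) = tensorSign (grade θ) CircleForm.grade (coaction θ x) := by
  have hA := (isDifferentialCalculus θ).toIsDGAlgebra
  have hH := CircleForm.isDifferentialCalculus.toIsDGAlgebra
  have h1 : tensorD (grade θ) (d θ) CircleForm.grade CircleForm.d 1 = 0 := by
    have hd : d θ 1 = 0 := by simpa using d_algebraMap θ 1
    have he : CircleForm.d 1 = 0 := by simpa using CircleForm.d_algebraMap 1
    change tensorD _ _ _ _ (1 ᵍ⊗ₜ[ℂ] 1) = 0
    rw [tensorD_tmul, hd, he, gtmul_zero_left, gtmul_zero_right, add_zero]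
  have h2 : tensorSign (grade θ) CircleForm.grade 1 = 1 := by
    have hd : sgn θ 1 = 1 := by simpa using sgn_algebraMap θ 1
    have he : CircleForm.sgn 1 = 1 := by simpa using CircleForm.sgn_algebraMap 1
    change tensorSign _ _ (1 ᵍ⊗ₜ[ℂ] 1) = _
    rw [tensorSign_tmul, sgn_eq, CircleForm.sgn_eq, hd, he]
    rfl
  induction x using TorusForm.induction with
  | hc c =>
    rw [d_algebraMap, sgn_algebraMap, AlgHom.commutes, map_zero, Algebra.algebraMap_eq_smul_one,
      map_smul, map_smul, h1, h2, smul_zero]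
    exact ⟨rfl, rfl⟩
  | hg g =>
    have e (g : TorusGen) : sgn θ (gen θ (.fn g)) = gen θ (.fn g) := sgn_gen θ (.fn g)
    have et : CircleForm.sgn (CircleForm.gen .t) = CircleForm.gen .t := CircleForm.sgn_gen .t
    have ei : CircleForm.sgn (CircleForm.gen .tInv) = CircleForm.gen .tInv :=
      CircleForm.sgn_gen .tInv
    have ed : CircleForm.sgn (CircleForm.gen .dt) = -CircleForm.gen .dt := CircleForm.sgn_gen .dt
    have edi : CircleForm.sgn (CircleForm.dGen .tInv) = -CircleForm.dGen .tInv := by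
      simp [CircleForm.dGen, CircleForm.sgn_mul, ei, ed]
    have edd : CircleForm.d (CircleForm.dGen .tInv) = 0 := by
      rw [← CircleForm.d_gen, CircleForm.d_d]
    rcases g with (_ | _ | _ | _) | _ | _
    · simp only [d_gen, dGen, coaction_gen, coactionGen, tensorD_tmul,
        tensorSign_tmul, sgn_eq, CircleForm.sgn_eq, e, et, CircleForm.d_gen, CircleForm.dGen,
        and_self]
    · refine ⟨?_, ?_⟩
      · simp only [d_gen, dGen, map_neg, map_mul, coaction_gen, coactionGen, tensorD_tmul, sgn_eq,
          e, CircleForm.d_gen, mul_add, add_mul, gtmul_mul_left _ _ _ CircleForm.tInv_mem,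
          gtmul_mul_right _ _ _ _ (uu_mem θ _), gen_uInv_u, CircleForm.gen_tInv_t,
          CircleForm.dGen, gtmul_neg_left, gtmul_neg_right, one_mul, neg_add]
      · simp only [coaction_gen, coactionGen, tensorSign_tmul, sgn_eq,
          CircleForm.sgn_eq, e, ei]
    · simp only [d_gen, dGen, coaction_gen, coactionGen, tensorD_tmul,
        tensorSign_tmul, sgn_eq, CircleForm.sgn_eq, e, ei, CircleForm.d_gen, and_self]
    · refine ⟨?_, ?_⟩
      · simp only [d_gen, dGen, map_neg, map_mul, coaction_gen, coactionGen, tensorD_tmul, sgn_eq,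
          e, CircleForm.d_gen, mul_add, add_mul, gtmul_mul_left _ _ _ CircleForm.t_mem,
          gtmul_mul_right _ _ _ _ (uu_mem θ _), gen_vInv_v, CircleForm.gen_t_tInv,
          CircleForm.t_mul_dGen_tInv_mul_t, gtmul_neg_left, gtmul_neg_right, one_mul, neg_add,
          neg_neg]
        rfl
      · simp only [coaction_gen, coactionGen, tensorSign_tmul, sgn_eq,
          CircleForm.sgn_eq, e, et]
    · simp only [d_gen, dGen, sgn_gen, signGen, coaction_gen, coactionGen, tensorD_tmul, map_add,
        tensorSign_tmul, sgn_eq, CircleForm.sgn_eq, e, et, ed, CircleForm.d_gen, CircleForm.dGen,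
        map_zero, map_neg, gtmul_zero_left, gtmul_zero_right, gtmul_neg_left, gtmul_neg_right]
      constructor <;> abel
    · simp only [d_gen, dGen, sgn_gen, signGen, coaction_gen, coactionGen, tensorD_tmul, map_add,
        tensorSign_tmul, sgn_eq, CircleForm.sgn_eq, e, ei, edi, edd, CircleForm.d_gen,
        map_zero, map_neg, gtmul_zero_left, gtmul_zero_right, gtmul_neg_left, gtmul_neg_right]
      constructor <;> abel
  | ha x y hx hy => simp only [map_add, hx.1, hx.2, hy.1, hy.2, and_self]
  | hm x y hx hy =>
    rw [d_mul, sgn_mul, map_add, map_mul (coaction θ), map_mul (coaction θ),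
      map_mul (coaction θ) x, map_mul (coaction θ), hx.1, hx.2, hy.1, hy.2,
      tensorD_mul _ _ hA hH, tensorSign_mul]
    exact ⟨rfl, rfl⟩

end TorusForm

/-- The calculus on the torus is complete. -/
theorem torus_calculus_complete (θ : ℝ) : IsCompleteExtension (TorusForm.incl θ)
    (TorusForm.grade θ) (TorusForm.d θ) CircleForm.incl CircleForm.grade CircleForm.d
    (torusCoaction θ) (TorusForm.coaction θ) where
  extends_coaction := TorusForm.coaction_incl θ
  map_d x := (TorusForm.coaction_d_aux θ x).1
  map_grade := by
    have h0 (a : NCTorus θ) : TorusForm.coaction θ (TorusForm.incl θ a) ∈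
        tensorGrade (TorusForm.grade θ) CircleForm.grade 0 := by
      rw [TorusForm.coaction_incl]
      generalize torusCoaction θ a = z
      induction z with
      | zero => rw [map_zero, map_zero]; exact zero_mem _
      | add x y hx hy => rw [map_add, map_add]; exact add_mem hx hy
      | tmul x y =>
        exact tmul_mem_tensorGrade _ _ (mem_formGrade_zero _ _ _) (mem_formGrade_zero _ _ _) rfl
    have h1 (a : NCTorus θ) : TorusForm.coaction θ (TorusForm.d θ (TorusForm.incl θ a)) ∈
        tensorGrade (TorusForm.grade θ) CircleForm.grade 1 := by
      rw [(TorusForm.coaction_d_aux θ _).1]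
      exact tensorD_mem _ _ (TorusForm.isDifferentialCalculus θ).toIsDGAlgebra
        CircleForm.isDifferentialCalculus.toIsDGAlgebra (h0 a)
    have h2 : ∀ k, ∀ x ∈ LinearMap.range (TorusForm.d θ ∘ₗ (TorusForm.incl θ).toLinearMap) ^ k,
        TorusForm.coaction θ x ∈ tensorGrade (TorusForm.grade θ) CircleForm.grade k := by
      intro k x hx
      induction hx using Submodule.pow_induction_on_left' with
      | algebraMap r =>
        have := h0 (algebraMap ℂ _ r)
        rwa [AlgHom.commutes] at this
      | add x y k hx hy ihx ihy => rw [map_add]; exact add_mem ihx ihy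
      | mem_mul m hm k x hx ih =>
        obtain ⟨a, rfl⟩ := hm
        rw [map_mul, Nat.succ_eq_one_add]
        exact tensorGrade_mul _ _ (h1 a) ih
    intro k x hx
    refine Submodule.mul_induction_on hx ?_ ?_
    · rintro _ ⟨a, rfl⟩ y hy
      rw [map_mul, ← zero_add k]
      exact tensorGrade_mul _ _ (h0 a) (h2 k y hy)
    · intro x y hx hy
      rw [map_add]
      exact add_mem hx hy

/-! Put `w = uv` and let `dlogU = u⁻¹ du`, `dlogV = v⁻¹ dv`, `dlogW = dlogU + dlogV = w⁻¹ dw`. Both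
equalities come from one closed chain of inclusions in degree 1: base forms ⊆ coinvariant horizontal
forms ⊆ span of the `wᵏ dw` ⊆ `B dB` ⊆ base forms. Three links are formal: `Δ(ω) = ω ⊗ 1` makes `ω`
horizontal and coinvariant, `w` is coinvariant, and a morphism of differential graded algebras sends
`b db'` to `b db' ⊗ 1` when `b` and `b'` are coinvariant. The content is the second link.

The torus algebra is spanned by the monomials `wᵏ uⁿ` (`NCTorus.span_monomials`), and `δ(wᵏ uⁿ) = wᵏ
uⁿ ⊗ tⁿ`. The forms `dlogU` and `dlogW` commute with `A`, and every 1-form is `a dlogU + b dlogW`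
with `a, b ∈ A` (`TorusForm.exists_eq_of_mem_grade_one`). Their coactions are `Δ(dlogU) = dlogU ⊗ 1
+ 1 ⊗ t⁻¹ dt` and `Δ(dlogW) = dlogW ⊗ 1`; in the second, the vertical contributions of `u` and `v`
cancel.

If `ω = a dlogU + b dlogW` is horizontal, apply to the second tensor factor of `Δ(ω)` the functional
`evalOne`, which kills `H` and sends every `tⁿ⁻¹ dt` to 1. The result is exactly `a`, so `a = 0` and
`ω = b dlogW`. If `ω` is also coinvariant, extracting the coefficient of `t⁰` from `(id ⊗ π₀)Δ(ω) =
ω ⊗ 1` leaves `ω` unchanged, while it kills each `wᵏ uⁿ dlogW` with `n ≠ 0`. Hence `ω` is a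
combination of the forms `wᵏ dlogW = wᵏ⁻¹ dw`.

Only spanning is used. Neither linear independence of the monomials nor freeness of the 1-forms over
`A` is needed, because the coefficients are recovered by linear maps defined on all of `Ω(A) ⊗
Ω(H)`. -/

section General

variable {A H ΩA ΩH : Type} [Ring A] [Algebra ℂ A] [Ring H] [Algebra ℂ H]
  [Ring ΩA] [Algebra ℂ ΩA] [Ring ΩH] [Algebra ℂ ΩH]
  (G : ℕ → Submodule ℂ ΩA) [GradedAlgebra G] (K : ℕ → Submodule ℂ ΩH) [GradedAlgebra K]

/-! ### Base, horizontal and coinvariant forms for a general coaction -/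

/-- Base forms are horizontal. -/
theorem baseForms_le_horizontalForms (Δ : ΩA →ₐ[ℂ] G ᵍ⊗[ℂ] K) (k : ℕ) :
    baseForms G K Δ k ≤ horizontalForms G K Δ k := by
  rintro x ⟨hx, hΔ⟩
  refine ⟨hx, x ⊗ₜ ⟨1, SetLike.GradedOne.one_mem⟩, ?_⟩
  exact (LinearMap.mem_eqLocus.mp hΔ).symm

/-- Base forms are coinvariant. -/
theorem baseForms_le_coinvariantForms (Δ : ΩA →ₐ[ℂ] G ᵍ⊗[ℂ] K) (k : ℕ) :
    baseForms G K Δ k ≤ coinvariantForms G K Δ k := by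
  rintro x ⟨hx, hΔ⟩
  refine ⟨hx, LinearMap.mem_eqLocus.mpr ?_⟩
  have h : Δ x = x ᵍ⊗ₜ[ℂ] (1 : ΩH) := LinearMap.mem_eqLocus.mp hΔ
  -- The unit is homogeneous of degree 0, so `π₀` fixes it and `id ⊗ π₀` fixes `x ⊗ 1`.
  have h1 : GradedAlgebra.proj K 0 (1 : ΩH) = 1 :=
    DirectSum.decompose_of_mem_same K SetLike.GradedOne.one_mem
  change GradedTensorProduct.of ℂ G K (TensorProduct.map LinearMap.id (GradedAlgebra.proj K 0)
    ((GradedTensorProduct.of ℂ G K).symm (Δ x))) = x ᵍ⊗ₜ[ℂ] (1 : ΩH)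
  rw [h]
  change GradedTensorProduct.of ℂ G K (x ⊗ₜ GradedAlgebra.proj K 0 (1 : ΩH)) = _
  rw [h1]

/-- The forms `B dB` on the coinvariants `B` of the coaction on a complete calculus are base
forms. -/
theorem subalgebraForms_le_baseForms {iA : A →ₐ[ℂ] ΩA} {d : ΩA →ₗ[ℂ] ΩA} {iH : H →ₐ[ℂ] ΩH}
    {e : ΩH →ₗ[ℂ] ΩH} {δ : A →ₐ[ℂ] A ⊗[ℂ] H} {Δ : ΩA →ₐ[ℂ] G ᵍ⊗[ℂ] K}
    (hA : IsDifferentialCalculus iA G d) (hH : IsDGAlgebra K e)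
    (h : IsCompleteExtension iA G d iH K e δ Δ) :
    subalgebraForms iA d (coinvariants δ) ≤ baseForms G K Δ 1 := by
  -- Leibniz on `1 * 1` gives `e 1 = e 1 + e 1`.
  have he : e 1 = 0 := by
    have := hH.leibniz 0 1 SetLike.GradedOne.one_mem 1
    simpa using this
  have hi : ∀ b ∈ coinvariants δ, Δ (iA b) = iA b ᵍ⊗ₜ[ℂ] (1 : ΩH) := by
    intro b hb
    have hb : δ b = b ⊗ₜ 1 := hb
    rw [h.extends_coaction, hb, TensorProduct.map_tmul]
    simp [GradedTensorProduct.tmul]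
  refine Submodule.span_le.mpr ?_
  rintro _ ⟨b, hb, b', hb', rfl⟩
  have hmem (a : A) : iA a ∈ G 0 := hA.grade_zero ▸ ⟨a, rfl⟩
  refine ⟨by simpa using SetLike.mul_mem_graded (hmem b) (hA.d_mem 0 _ (hmem b')), ?_⟩
  change Δ (iA b * d (iA b')) = (iA b * d (iA b')) ᵍ⊗ₜ[ℂ] (1 : ΩH)
  -- Since `e 1 = 0`, the total differential of `b' ⊗ 1` is `db' ⊗ 1`. The factor 1 of `b ⊗ 1` has
  -- degree 0, so no sign appears in the product.
  rw [map_mul, h.map_d, hi b hb, hi b' hb', tensorD_tmul, he, gtmul_zero_right, add_zero,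
    gtmul_mul_left G K _ SetLike.GradedOne.one_mem, one_mul]

/-- The map `x ⊗ y ↦ φ(y) x` on the graded tensor product. -/
noncomputable def sliceRight (φ : ΩH →ₗ[ℂ] ℂ) : (G ᵍ⊗[ℂ] K) →ₗ[ℂ] ΩA :=
  (TensorProduct.rid ℂ ΩA).toLinearMap ∘ₗ TensorProduct.map LinearMap.id φ ∘ₗ
    (GradedTensorProduct.of ℂ G K).symm.toLinearMap

theorem sliceRight_tmul (φ : ΩH →ₗ[ℂ] ℂ) (x : ΩA) (y : ΩH) :
    sliceRight G K φ (x ᵍ⊗ₜ[ℂ] y) = φ y • x := rfl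

/-- Functionals vanishing on `H` annihilate horizontal forms. -/
theorem sliceRight_of_mem_horizontalForms (φ : ΩH →ₗ[ℂ] ℂ) (hφ : ∀ y ∈ K 0, φ y = 0)
    {Δ : ΩA →ₐ[ℂ] G ᵍ⊗[ℂ] K} {k : ℕ} {x : ΩA} (hx : x ∈ horizontalForms G K Δ k) :
    sliceRight G K φ (Δ x) = 0 := by
  obtain ⟨-, z, hz⟩ := hx
  -- Horizontality provides `z ∈ Ω(A) ⊗ K 0` with image `Δ(x)`; on a pure tensor `a ⊗ y` of that
  -- space the slice is `φ(y) a = 0`.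
  suffices sliceRight G K φ (GradedTensorProduct.of ℂ G K
      (TensorProduct.map LinearMap.id (K 0).subtype z)) = 0 from (congrArg _ hz.symm).trans this
  clear hz
  induction z with
  | zero => simp
  | add z z' h h' => rw [map_add, map_add, map_add, h, h', add_zero]
  | tmul a y =>
    change φ y • a = 0
    rw [hφ _ y.2, zero_smul]

end General

/-! ### The monomials `wᵏ uⁿ` and their weights -/

namespace NCTorus

/-- The invertible coinvariant `w = uv`. -/
noncomputable abbrev w (θ : ℝ) : (NCTorus θ)ˣ := u θ * v θ

/-- The scalar `e^{-iθ}` as an invertible element. -/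
noncomputable def phase (θ : ℝ) : (NCTorus θ)ˣ :=
  Units.map (algebraMap ℂ (NCTorus θ)).toMonoidHom
    (Units.mk0 (Complex.exp (-(θ * Complex.I))) (Complex.exp_ne_zero _))

/-- The phase is treated as a unit of the algebra so that commutation rules become identities in the
group of units, where integer powers are available. This converts back to scalars; the value of the
scalar is irrelevant because it is only used to test membership in a span. -/
theorem phase_zpow_mul (θ : ℝ) (k : ℤ) :
    ∃ c : ℂ, ∀ x : NCTorus θ, ((phase θ ^ k : (NCTorus θ)ˣ) : NCTorus θ) * x = c • x := by
  refine ⟨((Units.mk0 (Complex.exp (-(θ * Complex.I))) (Complex.exp_ne_zero _) ^ k : ℂˣ) : ℂ),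
    fun x => ?_⟩
  rw [phase, ← map_zpow, Algebra.smul_def]
  rfl

theorem phase_commute (θ : ℝ) (x : (NCTorus θ)ˣ) : Commute (phase θ) x :=
  Units.ext (Algebra.commutes _ _)

theorem u_mul_v (θ : ℝ) : u θ * v θ = phase θ * (v θ * u θ) := by
  ext
  change gen θ .u * gen θ .v = algebraMap ℂ _ _ * (gen θ .v * gen θ .u)
  rw [gen_comm, Algebra.smul_def]
  rfl

/-- Substitute `uv = phase · vu` for the factor `uv` in `u · uv`, then move the central phase to the
front. -/
theorem u_conj_w (θ : ℝ) : u θ * w θ * (u θ)⁻¹ = phase θ * w θ := by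
  rw [mul_inv_eq_iff_eq_mul]
  calc u θ * (u θ * v θ) = u θ * phase θ * (v θ * u θ) := by rw [mul_assoc, ← u_mul_v]
    _ = phase θ * (u θ * v θ) * u θ := by rw [← (phase_commute θ (u θ)).eq]; simp only [mul_assoc]

/-- Conjugation by `u` is a group automorphism multiplying `w` by a central element, so it
multiplies `wᵏ` by the `k`-th power of that element, for negative `k` too. -/
theorem u_mul_w_zpow (θ : ℝ) (k : ℤ) : u θ * w θ ^ k = phase θ ^ k * (w θ ^ k * u θ) := by
  rw [← mul_assoc, ← (phase_commute θ (w θ)).mul_zpow, ← u_conj_w, conj_zpow,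
    inv_mul_cancel_right]

theorem uInv_mul_w_zpow (θ : ℝ) (k : ℤ) :
    (u θ)⁻¹ * w θ ^ k = phase θ ^ (-k) * (w θ ^ k * (u θ)⁻¹) := by
  rw [inv_mul_eq_iff_eq_mul, ← mul_assoc, ← ((phase_commute θ (u θ)).zpow_left _).eq, mul_assoc,
    ← mul_assoc (u θ), u_mul_w_zpow]
  simp [mul_assoc]

/-- With `v = u⁻¹ w` and `v⁻¹ = w⁻¹ u`, stability of the span under `v` and `v⁻¹` follows from
stability under powers of `w` and under `u`, `u⁻¹`. -/
theorem gen_v (θ : ℝ) : gen θ .v = gen θ .uInv * (w θ : NCTorus θ) := by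
  change _ = gen θ .uInv * (gen θ .u * gen θ .v)
  rw [← mul_assoc, gen_uInv_u, one_mul]

theorem gen_vInv (θ : ℝ) : gen θ .vInv = ((w θ)⁻¹ : (NCTorus θ)ˣ) * gen θ .u := by
  rw [mul_inv_rev]
  change _ = gen θ .vInv * gen θ .uInv * gen θ .u
  rw [mul_assoc, gen_uInv_u, mul_one]

/-- The monomials `wᵏ uⁿ` span the torus algebra. -/
theorem span_monomials (θ : ℝ) : Submodule.span ℂ (Set.range fun p : ℤ × ℤ =>
    ((w θ ^ p.1 * u θ ^ p.2 : (NCTorus θ)ˣ) : NCTorus θ)) = ⊤ := by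
  set T := Submodule.span ℂ (Set.range fun p : ℤ × ℤ =>
    ((w θ ^ p.1 * u θ ^ p.2 : (NCTorus θ)ˣ) : NCTorus θ)) with hT
  -- Left multiplication by `a` is linear, so it preserves the span `T` once it sends each monomial
  -- into `T`.
  have closed (a : NCTorus θ)
      (h : ∀ k n : ℤ, a * ((w θ ^ k * u θ ^ n : (NCTorus θ)ˣ) : NCTorus θ) ∈ T) :
      ∀ x ∈ T, a * x ∈ T := by
    intro x hx
    induction hx using Submodule.span_induction with
    | zero => rw [mul_zero]; exact zero_mem _
    | add x y _ _ hx hy => rw [mul_add]; exact add_mem hx hy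
    | smul c x _ hx => rw [mul_smul_comm]; exact Submodule.smul_mem _ c hx
    | mem x hx =>
      obtain ⟨p, rfl⟩ := hx
      exact h _ _
  have hu : ∀ x ∈ T, gen θ .u * x ∈ T := closed _ fun k n => by
    have : gen θ .u * ((w θ ^ k * u θ ^ n : (NCTorus θ)ˣ) : NCTorus θ) =
        ((phase θ ^ k : (NCTorus θ)ˣ) : NCTorus θ) *
          ((w θ ^ k * u θ ^ (n + 1) : (NCTorus θ)ˣ) : NCTorus θ) := by
      change ((u θ * (w θ ^ k * u θ ^ n) : (NCTorus θ)ˣ) : NCTorus θ) =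
        ((phase θ ^ k * (w θ ^ k * u θ ^ (n + 1)) : (NCTorus θ)ˣ) : NCTorus θ)
      rw [← mul_assoc, u_mul_w_zpow, add_comm n, zpow_add, zpow_one]
      simp only [mul_assoc]
    obtain ⟨c, hc⟩ := phase_zpow_mul θ k
    rw [this, hc]
    exact Submodule.smul_mem _ c (Submodule.subset_span ⟨(k, n + 1), rfl⟩)
  have hui : ∀ x ∈ T, gen θ .uInv * x ∈ T := closed _ fun k n => by
    have : gen θ .uInv * ((w θ ^ k * u θ ^ n : (NCTorus θ)ˣ) : NCTorus θ) =
        ((phase θ ^ (-k) : (NCTorus θ)ˣ) : NCTorus θ) *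
          ((w θ ^ k * u θ ^ (-1 + n) : (NCTorus θ)ˣ) : NCTorus θ) := by
      change (((u θ)⁻¹ * (w θ ^ k * u θ ^ n) : (NCTorus θ)ˣ) : NCTorus θ) =
        ((phase θ ^ (-k) * (w θ ^ k * u θ ^ (-1 + n)) : (NCTorus θ)ˣ) : NCTorus θ)
      rw [← mul_assoc, uInv_mul_w_zpow, zpow_add, zpow_neg_one]
      simp only [mul_assoc]
    obtain ⟨c, hc⟩ := phase_zpow_mul θ (-k)
    rw [this, hc]
    exact Submodule.smul_mem _ c (Submodule.subset_span ⟨(k, -1 + n), rfl⟩)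
  have hw (m : ℤ) : ∀ x ∈ T, ((w θ ^ m : (NCTorus θ)ˣ) : NCTorus θ) * x ∈ T :=
    closed _ fun k n => by
      rw [← Units.val_mul, ← mul_assoc, ← zpow_add]
      exact Submodule.subset_span ⟨(m + k, n), rfl⟩
  -- `T` is a left ideal, because stability under left multiplication passes to sums and products of
  -- elements `a`. As `1 = w⁰ u⁰` lies in `T`, it is everything.
  have key (a : NCTorus θ) : ∀ x ∈ T, a * x ∈ T := by
    induction a using NCTorus.induction with
    | hc c => intro x hx; rw [← Algebra.smul_def]; exact Submodule.smul_mem _ c hx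
    | ha a b h h' => intro x hx; rw [add_mul]; exact add_mem (h x hx) (h' x hx)
    | hm a b h h' => intro x hx; rw [mul_assoc]; exact h _ (h' x hx)
    | hg g =>
      intro x hx
      cases g with
      | u => exact hu x hx
      | uInv => exact hui x hx
      | v => rw [gen_v, mul_assoc]; simpa using hui _ (hw 1 x hx)
      | vInv => rw [gen_vInv, mul_assoc, ← zpow_neg_one]; exact hw (-1) _ (hu x hx)
  refine eq_top_iff.mpr fun a _ => ?_
  have h1 : (1 : NCTorus θ) ∈ T := Submodule.subset_span ⟨(0, 0), by simp⟩
  simpa using key a 1 h1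

/-- The homogeneous elements `x ⊗ tⁿ` with `x` invertible. -/
noncomputable def tmulT (θ : ℝ) :
    (NCTorus θ)ˣ × Multiplicative ℤ →* NCTorus θ ⊗[ℂ] ℂ[T;T⁻¹] where
  toFun p := (p.1 : NCTorus θ) ⊗ₜ LaurentPolynomial.T p.2.toAdd
  map_one' := rfl
  map_mul' p q := by
    rw [Algebra.TensorProduct.tmul_mul_tmul, ← LaurentPolynomial.T_add]
    rfl

theorem map_coaction_u (θ : ℝ) : Units.map (torusCoaction θ).toRingHom.toMonoidHom (u θ) =
    (tmulT θ).toHomUnits (u θ, Multiplicative.ofAdd 1) :=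
  Units.ext (lift_gen _ _ _ _ _ _ .u)

theorem map_coaction_v (θ : ℝ) : Units.map (torusCoaction θ).toRingHom.toMonoidHom (v θ) =
    (tmulT θ).toHomUnits (v θ, Multiplicative.ofAdd (-1)) :=
  Units.ext (lift_gen _ _ _ _ _ _ .v)

/-- On units, the coaction and `tmulT` are both group homomorphisms. Tracking the weight as a second
component of `tmulT` reduces the claim for integer powers to the two generators `u` and `v`. -/
theorem coaction_monomial (θ : ℝ) (k n : ℤ) :
    torusCoaction θ ((w θ ^ k * u θ ^ n : (NCTorus θ)ˣ) : NCTorus θ) =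
      ((w θ ^ k * u θ ^ n : (NCTorus θ)ˣ) : NCTorus θ) ⊗ₜ LaurentPolynomial.T n := by
  have h : Units.map (torusCoaction θ).toRingHom.toMonoidHom (w θ ^ k * u θ ^ n) =
      (tmulT θ).toHomUnits (w θ ^ k * u θ ^ n, Multiplicative.ofAdd n) := by
    rw [map_mul, map_zpow, map_zpow, map_mul, map_coaction_u, map_coaction_v, ← map_mul,
      ← map_zpow, ← map_zpow, ← map_mul]
    congr 1
    refine Prod.ext rfl ?_
    -- The weights of `u` and `v` are 1 and -1, so `w` has weight 0 and `wᵏ uⁿ` has weight `n`.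
    change (Multiplicative.ofAdd (1 : ℤ) * Multiplicative.ofAdd (-1 : ℤ)) ^ k *
      Multiplicative.ofAdd (1 : ℤ) ^ n = Multiplicative.ofAdd n
    rw [← ofAdd_add, add_neg_cancel, ofAdd_zero, one_zpow, one_mul, ← ofAdd_zsmul, smul_eq_mul,
      mul_one]
  exact congrArg Units.val h

theorem w_zpow_mem_coinvariants (θ : ℝ) (k : ℤ) :
    ((w θ ^ k : (NCTorus θ)ˣ) : NCTorus θ) ∈ coinvariants (torusCoaction θ) := by
  have := coaction_monomial θ k 0
  rwa [zpow_zero, mul_one] at this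

end NCTorus

/-! ### Functionals on the forms of `ℂ[t, t⁻¹]` -/

namespace CircleForm

/-- The projection `Ω(H) → H` to degree zero, as an algebra map. -/
noncomputable def degZero : CircleForm →ₐ[ℂ] ℂ[T;T⁻¹] :=
  lift
    (fun
      | .t => LaurentPolynomial.T 1
      | .tInv => LaurentPolynomial.T (-1)
      | .dt => 0)
    { t_tInv := by rw [← LaurentPolynomial.T_add]; rfl
      tInv_t := by rw [← LaurentPolynomial.T_add]; rfl
      t_dt := by simp
      tInv_dt := by simp
      dt_dt := by simp }

theorem degZero_incl (p : ℂ[T;T⁻¹]) : degZero (incl p) = p := by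
  induction p using laurent_induction with
  | hc c => rw [AlgHom.commutes, AlgHom.commutes]
  | h1 => rw [incl_T_one]; exact lift_gen _ _ _
  | h2 => rw [incl_T_neg_one]; exact lift_gen _ _ _
  | ha x y hx hy => rw [map_add, map_add, hx, hy]
  | hm x y hx hy => rw [map_mul, map_mul, hx, hy]

/-- The algebra map to the dual numbers with `t ↦ 1`, `dt ↦ ε`. -/
noncomputable def toDual : CircleForm →ₐ[ℂ] DualNumber ℂ :=
  lift
    (fun
      | .t => 1
      | .tInv => 1
      | .dt => DualNumber.eps)
    { t_tInv := mul_one 1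
      tInv_t := mul_one 1
      t_dt := mul_comm _ _
      tInv_dt := mul_comm _ _
      dt_dt := DualNumber.eps_mul_eps }

/-- The coefficient of `t⁰` in degree zero. -/
noncomputable def coeffZero : CircleForm →ₗ[ℂ] ℂ :=
  Finsupp.lapply (0 : ℤ) ∘ₗ (AddMonoidAlgebra.coeffLinearEquiv ℂ).toLinearMap ∘ₗ degZero.toLinearMap

theorem coeffZero_incl_T (n : ℤ) :
    coeffZero (incl (LaurentPolynomial.T n)) = if n = 0 then 1 else 0 := by
  change (degZero (incl (LaurentPolynomial.T n))).coeff 0 = _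
  rw [degZero_incl, LaurentPolynomial.T_apply]

/-- The value of a 1-form `p dt` at `t = 1`. -/
noncomputable def evalOne : CircleForm →ₗ[ℂ] ℂ :=
  TrivSqZeroExt.sndHom ℂ ℂ ∘ₗ toDual.toLinearMap

/-- The unit `t` maps to the unit 1, hence so do all its integer powers. -/
theorem toDual_incl_T (n : ℤ) : toDual (incl (LaurentPolynomial.T n)) = 1 := by
  have h : Units.map toDual.toRingHom.toMonoidHom t = 1 := Units.ext (lift_gen _ _ .t)
  have := congrArg Units.val (map_zpow (Units.map toDual.toRingHom.toMonoidHom) t n)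
  rw [h, one_zpow] at this
  rw [incl_T]
  exact this

/-- The images of the powers of `t` in the dual numbers have no `ε` part. This vanishing on `H` is
what makes the slice by `evalOne` kill horizontal forms. -/
theorem evalOne_incl (p : ℂ[T;T⁻¹]) : evalOne (incl p) = 0 := by
  suffices evalOne ∘ₗ incl.toLinearMap = 0 from LinearMap.congr_fun this p
  refine LinearMap.ext fun p => ?_
  induction p using LaurentPolynomial.induction_on' with
  | add p q hp hq => rw [map_add, hp, hq, map_add]
  | C_mul_T n a =>
    rw [← LaurentPolynomial.smul_eq_C_mul, map_smul]
    change a • (toDual (incl (LaurentPolynomial.T n))).snd = 0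
    rw [toDual_incl_T, TrivSqZeroExt.snd_one, smul_zero]

theorem evalOne_eq_zero_of_mem {y : CircleForm} (hy : y ∈ grade 0) : evalOne y = 0 := by
  rw [isDifferentialCalculus.grade_zero] at hy
  obtain ⟨p, rfl⟩ := hy
  exact evalOne_incl p

/-- The value does not depend on `n`, so a single functional recovers the coefficient of `u⁻¹ du` on
monomials of every weight. -/
theorem evalOne_incl_T_mul (n : ℤ) :
    evalOne (incl (LaurentPolynomial.T n) * (gen .tInv * gen .dt)) = 1 := by
  have h1 : toDual (gen .tInv) = 1 := lift_gen _ _ _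
  have h2 : toDual (gen .dt) = DualNumber.eps := lift_gen _ _ _
  change (toDual (incl (LaurentPolynomial.T n) * (gen .tInv * gen .dt))).snd = 1
  rw [map_mul, map_mul, toDual_incl_T, h1, h2, one_mul, one_mul]
  rfl

end CircleForm

/-! ### The forms `u⁻¹ du`, `v⁻¹ dv`, `w⁻¹ dw` and their coaction -/

namespace TorusForm

open NCTorus (w)

/-- The central 1-form `u⁻¹ du`. -/
noncomputable def dlogU (θ : ℝ) : TorusForm θ := gen θ (.fn .uInv) * gen θ .du

/-- The central 1-form `v⁻¹ dv`. -/
noncomputable def dlogV (θ : ℝ) : TorusForm θ := gen θ (.fn .vInv) * gen θ .dv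

/-- Multiply `uv = e^{-iθ} vu` by `u⁻¹` on both sides. The phase is the same as that of `du v`,
which makes `u⁻¹ du` commute with `v`. -/
theorem gen_v_uInv (θ : ℝ) : gen θ (.fn .v) * gen θ (.fn .uInv) =
    Complex.exp (-(θ * Complex.I)) • (gen θ (.fn .uInv) * gen θ (.fn .v)) := by
  have h := congrArg (fun x => gen θ (.fn .uInv) * x * gen θ (.fn .uInv)) (gen_comm θ)
  simp only [mul_smul_comm, smul_mul_assoc] at h
  rwa [← mul_assoc, gen_uInv_u, one_mul, mul_assoc, mul_assoc, gen_u_uInv, mul_one] at h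

/-- Multiply `uv = e^{-iθ} vu` by `v⁻¹` on both sides. The phase is inverse to that of `dv u`, which
makes `v⁻¹ dv` commute with `u`. -/
theorem gen_vInv_u (θ : ℝ) : gen θ (.fn .vInv) * gen θ (.fn .u) =
    Complex.exp (-(θ * Complex.I)) • (gen θ (.fn .u) * gen θ (.fn .vInv)) := by
  have h := congrArg (fun x => gen θ (.fn .vInv) * x * gen θ (.fn .vInv)) (gen_comm θ)
  simp only [mul_smul_comm, smul_mul_assoc] at h
  rwa [← mul_assoc, mul_assoc, gen_v_vInv, mul_one, ← mul_assoc, gen_vInv_v, one_mul] at h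

/-- An element commuting with `u` and `v` commutes with the torus algebra. -/
theorem commute_incl {θ : ℝ} {x : TorusForm θ}
    (hu : Commute x (incl θ (NCTorus.u θ : NCTorus θ)))
    (hv : Commute x (incl θ (NCTorus.v θ : NCTorus θ))) (a : NCTorus θ) :
    Commute x (incl θ a) := by
  induction a using NCTorus.induction with
  | hc c => rw [AlgHom.commutes]; exact Algebra.commute_algebraMap_right _ _
  | ha y z hy hz => rw [map_add]; exact hy.add_right hz
  | hm y z hy hz => rw [map_mul]; exact hy.mul_right hz
  | hg g =>
    cases g with
    | u => exact hu
    | v => exact hv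
    | uInv =>
      exact Commute.units_inv_right (u := Units.map (incl θ).toRingHom.toMonoidHom (NCTorus.u θ)) hu
    | vInv =>
      exact Commute.units_inv_right (u := Units.map (incl θ).toRingHom.toMonoidHom (NCTorus.v θ)) hv

theorem dlogU_commute (θ : ℝ) (a : NCTorus θ) : Commute (dlogU θ) (incl θ a) := by
  have hu : Commute (dlogU θ) (incl θ (NCTorus.u θ : NCTorus θ)) := by
    change _ * incl θ (NCTorus.gen θ .u) = incl θ (NCTorus.gen θ .u) * _
    rw [incl_gen, dlogU, mul_assoc, gen_du_u, ← mul_assoc, ← mul_assoc, gen_uInv_u, gen_u_uInv]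
  have hv : Commute (dlogU θ) (incl θ (NCTorus.v θ : NCTorus θ)) := by
    change _ * incl θ (NCTorus.gen θ .v) = incl θ (NCTorus.gen θ .v) * _
    rw [incl_gen, dlogU, mul_assoc, gen_du_v, ← mul_assoc (gen θ (.fn .v)), gen_v_uInv,
      mul_smul_comm, smul_mul_assoc, mul_assoc]
  exact commute_incl hu hv a

theorem dlogV_commute (θ : ℝ) (a : NCTorus θ) : Commute (dlogV θ) (incl θ a) := by
  have hu : Commute (dlogV θ) (incl θ (NCTorus.u θ : NCTorus θ)) := by
    change _ * incl θ (NCTorus.gen θ .u) = incl θ (NCTorus.gen θ .u) * _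
    rw [incl_gen, dlogV, mul_assoc, gen_dv_u, mul_smul_comm, ← mul_assoc, gen_vInv_u,
      smul_mul_assoc, smul_smul, exp_mul_exp', one_smul, mul_assoc]
  have hv : Commute (dlogV θ) (incl θ (NCTorus.v θ : NCTorus θ)) := by
    change _ * incl θ (NCTorus.gen θ .v) = incl θ (NCTorus.gen θ .v) * _
    rw [incl_gen, dlogV, mul_assoc, gen_dv_v, ← mul_assoc, ← mul_assoc, gen_vInv_v, gen_v_vInv]
  exact commute_incl hu hv a

/-- The central 1-form `w⁻¹ dw = u⁻¹ du + v⁻¹ dv`. -/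
noncomputable def dlogW (θ : ℝ) : TorusForm θ := dlogU θ + dlogV θ

theorem dlogW_commute (θ : ℝ) (a : NCTorus θ) : Commute (dlogW θ) (incl θ a) :=
  (dlogU_commute θ a).add_left (dlogV_commute θ a)

theorem u_mul_dlogU (θ : ℝ) : gen θ (.fn .u) * dlogU θ = gen θ .du := by
  rw [dlogU, ← mul_assoc, gen_u_uInv, one_mul]

theorem v_mul_dlogV (θ : ℝ) : gen θ (.fn .v) * dlogV θ = gen θ .dv := by
  rw [dlogV, ← mul_assoc, gen_v_vInv, one_mul]

/-- By Leibniz `dw = u dv + du v = uv dlogV + u dlogU v`, and `dlogU` commutes with `v`. -/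
theorem d_w (θ : ℝ) : d θ (incl θ (w θ : NCTorus θ)) = incl θ (w θ : NCTorus θ) * dlogW θ := by
  have hc := (dlogU_commute θ (NCTorus.gen θ .v)).eq
  rw [incl_gen] at hc
  change d θ (incl θ (NCTorus.gen θ .u * NCTorus.gen θ .v)) =
    incl θ (NCTorus.gen θ .u * NCTorus.gen θ .v) * dlogW θ
  rw [map_mul, d_incl_mul, incl_gen, incl_gen, d_gen, d_gen, dGen, dGen, dlogW, mul_add,
    ← u_mul_dlogU, mul_assoc, mul_assoc, hc, mul_assoc, v_mul_dlogV, add_comm]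

/-- Every 1-form is a combination of `u⁻¹ du` and `w⁻¹ dw` with coefficients in `A`. -/
theorem exists_eq_of_mem_grade_one (θ : ℝ) {x : TorusForm θ} (hx : x ∈ grade θ 1) :
    ∃ a b : NCTorus θ, x = incl θ a * dlogU θ + incl θ b * dlogW θ := by
  -- The elements whose differential lies in `A dlogU + A dlogV` are closed under products: in `dx ·
  -- y` the factor `y` moves to the left of both forms.
  have hd (a : NCTorus θ) : ∃ b c : NCTorus θ,
      d θ (incl θ a) = incl θ b * dlogU θ + incl θ c * dlogV θ := by
    induction a using NCTorus.induction with
    | hc c => exact ⟨0, 0, by rw [AlgHom.commutes, d_algebraMap]; simp⟩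
    | ha x y hx hy =>
      obtain ⟨b, c, h⟩ := hx
      obtain ⟨b', c', h'⟩ := hy
      exact ⟨b + b', c + c', by simp only [map_add, h, h', add_mul]; abel⟩
    | hm x y hx hy =>
      obtain ⟨b, c, h⟩ := hx
      obtain ⟨b', c', h'⟩ := hy
      refine ⟨x * b' + b * y, x * c' + c * y, ?_⟩
      rw [map_mul, d_incl_mul, h, h', add_mul, mul_assoc _ (dlogU θ), mul_assoc _ (dlogV θ),
        (dlogU_commute θ y).eq, (dlogV_commute θ y).eq]
      simp only [map_add, map_mul, add_mul, mul_add, mul_assoc]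
      abel
    | hg g =>
      rw [incl_gen, d_gen]
      cases g with
      | u => exact ⟨NCTorus.gen θ .u, 0, by simp [incl_gen, u_mul_dlogU, dGen]⟩
      | v => exact ⟨0, NCTorus.gen θ .v, by simp [incl_gen, v_mul_dlogV, dGen]⟩
      | uInv =>
        -- `d(u⁻¹) = -u⁻¹ du u⁻¹ = -dlogU u⁻¹ = -u⁻¹ dlogU`.
        refine ⟨-NCTorus.gen θ .uInv, 0, ?_⟩
        have hc := (dlogU_commute θ (NCTorus.gen θ .uInv)).eq
        rw [incl_gen] at hc
        rw [map_neg, incl_gen, neg_mul, ← hc, map_zero, zero_mul, add_zero]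
        rfl
      | vInv =>
        refine ⟨0, -NCTorus.gen θ .vInv, ?_⟩
        have hc := (dlogV_commute θ (NCTorus.gen θ .vInv)).eq
        rw [incl_gen] at hc
        rw [map_neg, incl_gen, neg_mul, ← hc, map_zero, zero_mul, zero_add]
        rfl
  rw [grade, formGrade, pow_one] at hx
  refine Submodule.mul_induction_on hx ?_ ?_
  · rintro _ ⟨a, rfl⟩ _ ⟨a', rfl⟩
    obtain ⟨b, c, h⟩ := hd a'
    -- Substitute `dlogV = dlogW - dlogU` in `a (b dlogU + c dlogV)`.
    refine ⟨a * b - a * c, a * c, ?_⟩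
    change incl θ a * d θ (incl θ a') = _
    rw [h, dlogW]
    simp only [map_sub, map_mul, mul_add, sub_mul, mul_assoc]
    abel
  · rintro x y ⟨a, b, rfl⟩ ⟨a', b', rfl⟩
    exact ⟨a + a', b + b', by simp only [map_add, add_mul]; abel⟩

/-- Multiply `Δ(du) = du ⊗ t + u ⊗ dt` by `u⁻¹ ⊗ t⁻¹`. The term `1 ⊗ t⁻¹ dt` is the vertical part,
the obstruction to being horizontal. -/
theorem coaction_dlogU (θ : ℝ) : coaction θ (dlogU θ) = dlogU θ ᵍ⊗ₜ[ℂ] (1 : CircleForm) +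
    (1 : TorusForm θ) ᵍ⊗ₜ[ℂ] (CircleForm.gen .tInv * CircleForm.gen .dt) := by
  rw [dlogU, map_mul, coaction_gen, coaction_gen]
  simp only [coactionGen]
  rw [mul_add, gtmul_mul_left _ _ _ CircleForm.tInv_mem, gtmul_mul_left _ _ _ CircleForm.tInv_mem,
    CircleForm.gen_tInv_t, gen_uInv_u]

/-- The sign is opposite to that for `u` because `t d(t⁻¹) = -t⁻¹ dt`. -/
theorem coaction_dlogV (θ : ℝ) : coaction θ (dlogV θ) = dlogV θ ᵍ⊗ₜ[ℂ] (1 : CircleForm) -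
    (1 : TorusForm θ) ᵍ⊗ₜ[ℂ] (CircleForm.gen .tInv * CircleForm.gen .dt) := by
  rw [dlogV, map_mul, coaction_gen, coaction_gen]
  simp only [coactionGen]
  rw [mul_add, gtmul_mul_left _ _ _ CircleForm.t_mem, gtmul_mul_left _ _ _ CircleForm.t_mem,
    CircleForm.gen_t_tInv, gen_vInv_v, CircleForm.t_mul_dGen_tInv, gtmul_neg_right,
    sub_eq_add_neg]

theorem coaction_dlogW (θ : ℝ) :
    coaction θ (dlogW θ) = dlogW θ ᵍ⊗ₜ[ℂ] (1 : CircleForm) := by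
  rw [dlogW, map_add, coaction_dlogU, coaction_dlogV, gtmul_add_left]
  abel

theorem coaction_monomial (θ : ℝ) (k n : ℤ) :
    coaction θ (incl θ ((w θ ^ k * NCTorus.u θ ^ n : (NCTorus θ)ˣ) : NCTorus θ)) =
      incl θ ((w θ ^ k * NCTorus.u θ ^ n : (NCTorus θ)ˣ) : NCTorus θ) ᵍ⊗ₜ[ℂ]
        CircleForm.incl (LaurentPolynomial.T n) := by
  rw [coaction_incl, NCTorus.coaction_monomial, TensorProduct.map_tmul]
  rfl

/-- Linear identities on the torus algebra may be checked on the monomials `wᵏ uⁿ`. -/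
theorem monomial_ext {θ : ℝ} {M : Type*} [AddCommGroup M] [Module ℂ M] {f g : NCTorus θ →ₗ[ℂ] M}
    (h : ∀ k n : ℤ, f ((w θ ^ k * NCTorus.u θ ^ n : (NCTorus θ)ˣ) : NCTorus θ) =
      g ((w θ ^ k * NCTorus.u θ ^ n : (NCTorus θ)ˣ) : NCTorus θ)) : f = g :=
  LinearMap.ext_on_range (NCTorus.span_monomials θ) fun p => h p.1 p.2

theorem incl_T_mem (n : ℤ) : CircleForm.incl (LaurentPolynomial.T n) ∈ CircleForm.grade 0 :=
  mem_formGrade_zero _ _ _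

/-! ### Coinvariant horizontal 1-forms -/

/-- Horizontal 1-forms are multiples of `w⁻¹ dw`. -/
theorem exists_eq_of_mem_horizontalForms (θ : ℝ) {x : TorusForm θ}
    (hx : x ∈ horizontalForms (grade θ) CircleForm.grade (coaction θ) 1) :
    ∃ b : NCTorus θ, x = incl θ b * dlogW θ := by
  have h0 := sliceRight_of_mem_horizontalForms _ _ CircleForm.evalOne
    (fun y hy => CircleForm.evalOne_eq_zero_of_mem hy) hx
  obtain ⟨a, b, rfl⟩ := exists_eq_of_mem_grade_one θ hx.1
  let L := sliceRight (grade θ) CircleForm.grade CircleForm.evalOne ∘ₗ (coaction θ).toLinearMap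
  -- For `a = wᵏ uⁿ`, `Δ(a dlogU) = a dlogU ⊗ tⁿ + a ⊗ tⁿ t⁻¹ dt`; `evalOne` kills the first term
  -- and leaves `a` from the second.
  have hU : L ∘ₗ LinearMap.mulRight ℂ (dlogU θ) ∘ₗ (incl θ).toLinearMap =
      (incl θ).toLinearMap := monomial_ext fun k n => by
    change sliceRight _ _ _ (coaction θ (incl θ _ * dlogU θ)) = incl θ _
    rw [map_mul, coaction_monomial, coaction_dlogU, mul_add,
      gtmul_mul_left _ _ _ (incl_T_mem n), gtmul_mul_left _ _ _ (incl_T_mem n), map_add,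
      sliceRight_tmul, sliceRight_tmul, mul_one, mul_one, CircleForm.evalOne_incl,
      CircleForm.evalOne_incl_T_mul, zero_smul, one_smul, zero_add]
  have hW : L ∘ₗ LinearMap.mulRight ℂ (dlogW θ) ∘ₗ (incl θ).toLinearMap = 0 :=
    monomial_ext fun k n => by
    change sliceRight _ _ _ (coaction θ (incl θ _ * dlogW θ)) = 0
    rw [map_mul, coaction_monomial, coaction_dlogW, gtmul_mul_left _ _ _ (incl_T_mem n),
      sliceRight_tmul, mul_one, CircleForm.evalOne_incl, zero_smul]
  -- The slice of `Δ(a dlogU + b dlogW)` is `a + 0`, and horizontality forces it to vanish.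
  have ha : incl θ a = 0 := by
    rw [map_add, map_add] at h0
    have h1 : sliceRight _ _ _ (coaction θ (incl θ a * dlogU θ)) = incl θ a :=
      LinearMap.congr_fun hU a
    have h2 : sliceRight _ _ _ (coaction θ (incl θ b * dlogW θ)) = 0 :=
      LinearMap.congr_fun hW b
    rwa [h1, h2, add_zero] at h0
  exact ⟨b, by rw [ha, zero_mul, zero_add]⟩

/-- The 1-form `wᵏ dw`. -/
theorem w_zpow_mul_d_w (θ : ℝ) (k : ℤ) :
    incl θ ((w θ ^ k : (NCTorus θ)ˣ) : NCTorus θ) * d θ (incl θ (w θ : NCTorus θ)) =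
      incl θ ((w θ ^ (k + 1) : (NCTorus θ)ˣ) : NCTorus θ) * dlogW θ := by
  rw [d_w, ← mul_assoc, ← map_mul, ← Units.val_mul, zpow_add_one]

/-- The coinvariant horizontal 1-forms are spanned by the `wᵏ dw`. -/
theorem coinvariant_horizontal_le_span (θ : ℝ) :
    horizontalForms (grade θ) CircleForm.grade (coaction θ) 1 ⊓
        coinvariantForms (grade θ) CircleForm.grade (coaction θ) 1 ≤
      Submodule.span ℂ (Set.range fun k : ℤ =>
        incl θ ((w θ ^ k : (NCTorus θ)ˣ) : NCTorus θ) * d θ (incl θ (w θ : NCTorus θ))) := by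
  rintro x ⟨hh, -, hc⟩
  obtain ⟨b, rfl⟩ := exists_eq_of_mem_horizontalForms θ hh
  have hc : formCoaction _ _ _ (incl θ b * dlogW θ) =
    (incl θ b * dlogW θ) ᵍ⊗ₜ[ℂ] (1 : CircleForm) := LinearMap.mem_eqLocus.mp hc
  set S := Submodule.span ℂ (Set.range fun k : ℤ =>
    incl θ ((w θ ^ k : (NCTorus θ)ˣ) : NCTorus θ) * d θ (incl θ (w θ : NCTorus θ)))
  -- `L` sends `a` to the weight-0 part of `a dlogW`. Coinvariance says that `b dlogW` is its own
  -- weight-0 part, so it suffices that the range of `L` lies in `S`, which can be checked on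
  -- monomials.
  let L := sliceRight (grade θ) CircleForm.grade CircleForm.coeffZero ∘ₗ
    formCoaction (grade θ) CircleForm.grade (coaction θ) ∘ₗ
      LinearMap.mulRight ℂ (dlogW θ) ∘ₗ (incl θ).toLinearMap
  have h1 : L b = incl θ b * dlogW θ := by
    change sliceRight _ _ _ (formCoaction _ _ _ (incl θ b * dlogW θ)) = _
    have h := CircleForm.coeffZero_incl_T 0
    rw [if_pos rfl, LaurentPolynomial.T_zero, map_one] at h
    rw [hc, sliceRight_tmul, h, one_smul]
  have hL (k n : ℤ) : L ((w θ ^ k * NCTorus.u θ ^ n : (NCTorus θ)ˣ) : NCTorus θ) ∈ S := by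
    have h2 : formCoaction (grade θ) CircleForm.grade (coaction θ)
        (incl θ ((w θ ^ k * NCTorus.u θ ^ n : (NCTorus θ)ˣ) : NCTorus θ) * dlogW θ) =
        (incl θ ((w θ ^ k * NCTorus.u θ ^ n : (NCTorus θ)ˣ) : NCTorus θ) * dlogW θ) ᵍ⊗ₜ[ℂ]
          CircleForm.incl (LaurentPolynomial.T n) := by
      -- Since `Δ(dlogW) = dlogW ⊗ 1`, the second factor of `Δ(wᵏ uⁿ dlogW)` is just `tⁿ`, already
      -- of degree 0, and `π₀` changes nothing.
      have h3 : GradedAlgebra.proj CircleForm.grade 0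
          (CircleForm.incl (LaurentPolynomial.T n)) = _ :=
        DirectSum.decompose_of_mem_same CircleForm.grade (incl_T_mem n)
      have h4 := coaction_monomial θ k n
      change GradedTensorProduct.of ℂ _ _ (TensorProduct.map LinearMap.id
        (GradedAlgebra.proj CircleForm.grade 0)
          ((GradedTensorProduct.of ℂ _ _).symm (coaction θ (_ * dlogW θ)))) = _
      rw [map_mul, h4, coaction_dlogW, gtmul_mul_left _ _ _ (incl_T_mem n), mul_one]
      change GradedTensorProduct.of ℂ _ _ (_ ⊗ₜ GradedAlgebra.proj CircleForm.grade 0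
        (CircleForm.incl (LaurentPolynomial.T n))) = _
      rw [h3]
      rfl
    change sliceRight _ _ _ (formCoaction _ _ _ (incl θ _ * dlogW θ)) ∈ S
    rw [h2, sliceRight_tmul, CircleForm.coeffZero_incl_T]
    split_ifs with hn
    · subst hn
      -- The exponent shifts by one: `wᵏ dlogW = wᵏ⁻¹ dw`.
      rw [one_smul, zpow_zero, mul_one, ← sub_add_cancel k 1, ← w_zpow_mul_d_w]
      exact Submodule.subset_span ⟨k - 1, rfl⟩
    · rw [zero_smul]
      exact zero_mem _
  have hb : b ∈ S.comap L := by
    have : (⊤ : Submodule ℂ (NCTorus θ)) ≤ S.comap L := by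
      rw [← NCTorus.span_monomials, Submodule.span_le]
      rintro _ ⟨p, rfl⟩
      exact hL _ _
    exact this trivial
  rw [← h1]
  exact hb

/-- The forms `wᵏ dw` belong to `B dB`. -/
theorem span_le_subalgebraForms (θ : ℝ) :
    Submodule.span ℂ (Set.range fun k : ℤ =>
        incl θ ((w θ ^ k : (NCTorus θ)ˣ) : NCTorus θ) * d θ (incl θ (w θ : NCTorus θ))) ≤
      subalgebraForms (incl θ) (d θ) (coinvariants (torusCoaction θ)) := by
  rw [Submodule.span_le]
  rintro _ ⟨k, rfl⟩
  refine Submodule.subset_span ⟨_, NCTorus.w_zpow_mem_coinvariants θ k, _, ?_, rfl⟩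
  simpa using NCTorus.w_zpow_mem_coinvariants θ 1

end TorusForm

theorem mainTheorem9 (θ : ℝ) :
    baseForms (TorusForm.grade θ) CircleForm.grade (TorusForm.coaction θ) 1 =
        subalgebraForms (TorusForm.incl θ) (TorusForm.d θ) (coinvariants (torusCoaction θ)) ∧
    horizontalForms (TorusForm.grade θ) CircleForm.grade (TorusForm.coaction θ) 1 ⊓
        coinvariantForms (TorusForm.grade θ) CircleForm.grade (TorusForm.coaction θ) 1 =
      Submodule.span ℂ (Set.range fun k : ℤ =>
        TorusForm.incl θ ↑((NCTorus.u θ * NCTorus.v θ) ^ k) *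
          TorusForm.d θ (TorusForm.incl θ ↑(NCTorus.u θ * NCTorus.v θ))) := by
  have h1 := le_inf
    (baseForms_le_horizontalForms (TorusForm.grade θ) CircleForm.grade (TorusForm.coaction θ) 1)
    (baseForms_le_coinvariantForms (TorusForm.grade θ) CircleForm.grade (TorusForm.coaction θ) 1)
  have h2 := TorusForm.coinvariant_horizontal_le_span θ
  have h3 := TorusForm.span_le_subalgebraForms θ
  have h4 := subalgebraForms_le_baseForms _ _ (TorusForm.isDifferentialCalculus θ)
    CircleForm.isDifferentialCalculus.toIsDGAlgebra (torus_calculus_complete θ)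
  -- The four inclusions form a cycle, so all four spaces coincide; the two equalities compare two
  -- pairs of them.
  exact ⟨le_antisymm (h1.trans (h2.trans h3)) h4, le_antisymm h2 (h3.trans (h4.trans h1))⟩
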